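/- For $a\in(0,1)$ and integers $l\ge 0$, let $\mu_{l,0}(a)<\mu_{l,1}(a)<\mu_{l,2}(a)<\cdots$ be the numbers $\mu$ for which the radial Neumann problem $$\psi''+\frac{\psi'}{r}-\frac{l^2\psi}{r^2}+\mu\,\psi=0\ \text{ in }(a,1),\qquad \psi'(a)=\psi'(1)=0,$$ has a nontrivial solution $\psi\in C^2([a,1])$, and let $\lambda_{l,0}(a)<\lambda_{l,1}(a)<\lambda_{l,2}(a)<\cdots$ be the numbers $\lambda$ for which the radial Dirichlet problem $$\varphi''+\frac{\varphi'}{r}-\frac{l^2\varphi}{r^2}+\lambda\,\varphi=0\ \text{ in }(a,1),\qquad \varphi(a)=\varphi(1)=0,$$ has a nontrivial solution $\varphi\in C^2([a,1])$. There exist an integer $L$ and a constant $C$ such that the following holds for every integer $l\ge L$. There is some $a\in(0,1)$ with $\mu_{0,2}(a)=\lambda_{l,0}(a)$. Moreover, every $a_l\in(0,1)$ with $\mu_{0,2}(a_l)=\lambda_{l,0}(a_l)$ satisfies $$\Big|a_l-\Big(1-\frac{\sqrt3\,\pi}{l}\Big)\Big|\le \frac{C}{l^{2}},\qquad \Big|a_l-\Big(1-\frac{\sqrt3\,\pi}{l}+\frac{3\pi^2}{2l^2}\Big)\Big|\le\frac{C}{l^{3}},$$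 that is, $a_l = 1-\frac{\sqrt3\pi}{l}+O(l^{-2})$ and $a_l = 1-\frac{\sqrt3\pi}{l}+\frac{3\pi^2}{2l^2}+O(l^{-3})$. In addition, the functions $a\mapsto\mu_{0,2}(a)$ and $a\mapsto\lambda_{l,0}(a)$ are differentiable at $a_l$, and $$\mu_{0,2}'(a_l)\neq\lambda_{l,0}'(a_l).$$ -/

import Mathlib

namespace Annulus

/-- `u` solves the radial eigenvalue equation `u'' + u'/r - l² u / r² + κ u = 0` on `(a, 1)`,
is of class `C²` up to the boundary, and does not vanish identically. -/
structure IsRadialSolution (l : ℕ) (a κ : ℝ) (u : ℝ → ℝ) : Prop where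
  contDiffOn : ContDiffOn ℝ 2 u (Set.Icc a 1)
  equation : ∀ r ∈ Set.Ioo a 1,
    deriv (deriv u) r + deriv u r / r - (l : ℝ) ^ 2 * u r / r ^ 2 + κ * u r = 0
  nontrivial : ∃ r ∈ Set.Icc a 1, u r ≠ 0

/-- The eigenvalues of the radial equation in mode `l` with Neumann conditions at `a` and `1`
(the derivatives at the endpoints are one-sided). -/
def neumannSpectrum (l : ℕ) (a : ℝ) : Set ℝ :=
  {κ | ∃ u : ℝ → ℝ, IsRadialSolution l a κ u ∧
    derivWithin u (Set.Icc a 1) a = 0 ∧ derivWithin u (Set.Icc a 1) 1 = 0}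

/-- The eigenvalues of the radial equation in mode `l` with Dirichlet conditions at `a` and `1`. -/
def dirichletSpectrum (l : ℕ) (a : ℝ) : Set ℝ :=
  {κ | ∃ u : ℝ → ℝ, IsRadialSolution l a κ u ∧ u a = 0 ∧ u 1 = 0}

/-- The increasing enumeration, starting with index `0`, of a set of reals that can be listed as
a strictly increasing sequence (see `enum_eq_of_strictMono`). The spectra above are such sets
when `0 < a < 1`, and all of their eigenvalues are simple. -/
noncomputable def enum (S : Set ℝ) : ℕ → ℝ
  | 0 => sInf S
  | n + 1 => sInf (S ∩ Set.Ioi (enum S n))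

theorem enum_eq_of_strictMono {S : Set ℝ} {e : ℕ → ℝ} (he : StrictMono e)
    (hS : Set.range e = S) (n : ℕ) : enum S n = e n := by
  subst hS
  induction n with
  | zero =>
    refine IsLeast.csInf_eq ⟨⟨0, rfl⟩, ?_⟩
    rintro _ ⟨m, rfl⟩
    exact he.monotone (Nat.zero_le m)
  | succ n ih =>
    simp only [enum, ih]
    refine IsLeast.csInf_eq ⟨⟨⟨n + 1, rfl⟩, he (Nat.lt_succ_self n)⟩, ?_⟩
    rintro _ ⟨⟨m, rfl⟩, hm⟩
    exact he.monotone (he.lt_iff_lt.1 hm)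

/-- `μ_{l,n}(a)`: the `n`-th radial Neumann eigenvalue in mode `l` of the annulus of radii `a`
and `1`, counting from `n = 0`. -/
noncomputable def neumannEigenvalue (l n : ℕ) (a : ℝ) : ℝ := enum (neumannSpectrum l a) n

/-- `λ_{l,n}(a)`: the `n`-th radial Dirichlet eigenvalue in mode `l` of the annulus of radii `a`
and `1`, counting from `n = 0`. -/
noncomputable def dirichletEigenvalue (l n : ℕ) (a : ℝ) : ℝ := enum (dirichletSpectrum l a) n

end Annulus

/-! With `t = log r`, `b = log a` and `κ = e^(2s)`, a translation by `s` turns mode `l` into the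
single equation `y'' + (e^(2t) - l²) y = 0` on the moving interval `(s + b, s)`. Write a fundamental
system in polar form with an increasing phase. For `l ≥ 1`, `κ` is a Dirichlet eigenvalue exactly
when the phase increment `phaseGap l s b` is a positive multiple of `π`. An energy identity shows
that the increment, as a function of `s`, crosses these multiples only upwards
(`lt_phaseGap_of_lt`), so each is attained once, at `eigenLog l n b`. The derivative of a Neumann
solution in mode `0` solves the Dirichlet problem in mode `1`. Hence `μ_{0,2}` is the second
Dirichlet eigenvalue of mode `1`, and the question is where `eigenLog 1 2` meets `eigenLog l 1`.

Asymptotics: comparing an eigenfunction with an explicit function having the same zeros gives its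
eigenvalue up to one unknown point `x` in the interval (`exists_exp_eq`). Sines suffice for mode
`1`: `μ_{0,2} = 4π²/(1-a)² + O(1)`. For mode `l` a Möbius-transformed sine is tuned so that `x`
drops out to first order. With `δ = 1 - a`, equality of the eigenvalues becomes `l²δ²/π² = 3 - 3δ +
O(δ²)`, which is solved for `δ`.

Transversality: implicit differentiation gives `eigenLog' = R/(1-R)`, where `R = boundaryRatio` is
the squared ratio of the boundary derivatives. At a crossing the eigenvalues agree, so it is enough
that the ratios differ. A multiplier identity puts them on opposite sides of `a²`: `R > a²` in mode
`1` (`exp_lt_boundaryRatio_one`), `R < a²` in mode `l` (`boundaryRatio_lt_exp`). -/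

namespace Annulus

open Set Filter Topology

/-! ### Global solutions of `y'' + q y = 0` and polar coordinates for a fundamental system. -/

section ExistenceODE

theorem abs_sin_sq_sub_sin_sq_le (x y : ℝ) : |Real.sin x ^ 2 - Real.sin y ^ 2| ≤ |x - y| := by
  have h : Real.sin x ^ 2 - Real.sin y ^ 2 = Real.sin (x - y) * Real.sin (x + y) := by
    rw [Real.sin_sub, Real.sin_add]
    nlinarith [Real.sin_sq_add_cos_sq x, Real.sin_sq_add_cos_sq y]
  rw [h, abs_mul]
  calc |Real.sin (x - y)| * |Real.sin (x + y)| ≤ |x - y| * 1 :=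
        mul_le_mul Real.abs_sin_le_abs (Real.abs_sin_le_one _) (abs_nonneg _) (abs_nonneg _)
    _ = |x - y| := mul_one _

/-- The Prüfer vector field of `y'' + q y = 0`. -/
noncomputable def prueferField (q : ℝ → ℝ) (t θ : ℝ) : ℝ := 1 + (q t - 1) * Real.sin θ ^ 2

theorem lipschitzWith_prueferField {q : ℝ → ℝ} {t : ℝ} {K : NNReal} (hK : |q t - 1| ≤ K) :
    LipschitzWith K (prueferField q t) := by
  refine LipschitzWith.of_dist_le_mul fun x y ↦ ?_
  rw [Real.dist_eq, Real.dist_eq]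
  have : prueferField q t x - prueferField q t y
      = (q t - 1) * (Real.sin x ^ 2 - Real.sin y ^ 2) := by
    simp only [prueferField]; ring
  rw [this, abs_mul]
  exact mul_le_mul hK (abs_sin_sq_sub_sin_sq_le x y) (abs_nonneg _) K.2

theorem exists_nnreal_bound {q : ℝ → ℝ} (hq : Continuous q) (T : ℝ) :
    ∃ K : NNReal, ∀ t ∈ Icc (-T) T, |q t - 1| ≤ K := by
  obtain ⟨C, hC⟩ := (isCompact_Icc (a := -T) (b := T)).exists_bound_of_continuousOn
    (f := fun t ↦ q t - 1) (by fun_prop)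
  refine ⟨Real.toNNReal C, fun t ht ↦ ?_⟩
  exact (hC t ht).trans (Real.le_coe_toNNReal C)

/-- Unlike the linear system, the angle equation has a vector field bounded independently of the
unknown, so Picard–Lindelöf covers the whole interval in one step. -/
theorem exists_pruefer_angle_Ioo {q : ℝ → ℝ} (hq : Continuous q) (θ₀ : ℝ) {T : ℝ} (hT : 0 < T) :
    ∃ θ : ℝ → ℝ, θ 0 = θ₀ ∧ ∀ t ∈ Ioo (-T) T, HasDerivAt θ (prueferField q t (θ t)) t := by
  obtain ⟨K, hK⟩ := exists_nnreal_bound hq T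
  have h0 : (0 : ℝ) ∈ Icc (-T) T := ⟨by linarith, hT.le⟩
  -- A field bounded by `1 + K` moves the angle by at most `(1 + K) T`, which is taken as the
  -- radius.
  have hPL : IsPicardLindelof (prueferField q) (⟨0, h0⟩ : Icc (-T) T) θ₀
      ((1 + K) * Real.toNNReal T) 0 (1 + K) K := by
    refine ⟨fun t ht ↦ (lipschitzWith_prueferField (hK t ht)).lipschitzOnWith, fun x _ ↦ ?_,
      fun t ht x _ ↦ ?_, ?_⟩
    · unfold prueferField; fun_prop
    · rw [Real.norm_eq_abs]
      have h1 := hK t ht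
      have h2 : Real.sin x ^ 2 ≤ 1 := Real.sin_sq_le_one x
      calc |prueferField q t x| ≤ |(1 : ℝ)| + |(q t - 1) * Real.sin x ^ 2| := abs_add_le _ _
        _ ≤ 1 + K * 1 := by
          rw [abs_one, abs_mul, abs_of_nonneg (sq_nonneg (Real.sin x))]
          gcongr
        _ = ((1 + K : NNReal) : ℝ) := by push_cast; ring
    · simp [hT.le]
  obtain ⟨θ, h1, h2⟩ := hPL.exists_eq_forall_mem_Icc_hasDerivWithinAt₀
  exact ⟨θ, h1, fun t ht ↦ (h2 t (Ioo_subset_Icc_self ht)).hasDerivAt (Icc_mem_nhds ht.1 ht.2)⟩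

theorem exists_pruefer_angle {q : ℝ → ℝ} (hq : Continuous q) (θ₀ : ℝ) :
    ∃ θ : ℝ → ℝ, θ 0 = θ₀ ∧ ∀ t, HasDerivAt θ (prueferField q t (θ t)) t := by
  have H (n : ℕ) := exists_pruefer_angle_Ioo hq θ₀ (T := n + 1) (by positivity)
  choose θ h0 hθ using H
  have agree (m n : ℕ) (hmn : m ≤ n) : EqOn (θ m) (θ n) (Ioo (-(m + 1)) (m + 1)) := by
    obtain ⟨K, hK⟩ := exists_nnreal_bound hq (m + 1)
    have hmn' : (m : ℝ) ≤ n := by exact_mod_cast hmn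
    refine ODE_solution_unique_of_mem_Ioo (v := prueferField q) (s := fun _ ↦ univ) (K := K)
      (t₀ := 0)
      (fun t ht ↦ (lipschitzWith_prueferField (hK t (Ioo_subset_Icc_self ht))).lipschitzOnWith)
      ⟨by linarith [m.cast_nonneg (α := ℝ)], by positivity⟩
      (fun t ht ↦ ⟨hθ m t ht, trivial⟩)
      (fun t ht ↦ ⟨hθ n t ⟨by linarith [ht.1], by linarith [ht.2]⟩, trivial⟩) ?_
    rw [h0, h0]
  -- The local solutions are glued by using at `t` the one with index `⌈|t|⌉₊`; near any point this
  -- agrees with a single fixed one.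
  have key (n : ℕ) (t : ℝ) (ht : |t| < n + 1) : θ ⌈|t|⌉₊ t = θ n t := by
    rcases le_total ⌈|t|⌉₊ n with h | h
    · exact agree _ _ h (abs_lt.1 ((Nat.le_ceil _).trans_lt (lt_add_one _)))
    · exact (agree _ _ h (abs_lt.1 ht)).symm
  refine ⟨fun t : ℝ ↦ θ ⌈|t|⌉₊ t, by simp [h0], fun t : ℝ ↦ ?_⟩
  obtain ⟨n, hn⟩ := exists_nat_gt |t|
  have hn' : |t| < n + 1 := hn.trans (lt_add_one _)
  have hev : (fun t : ℝ ↦ θ ⌈|t|⌉₊ t) =ᶠ[𝓝 t] (θ n) := by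
    have : ∀ᶠ x : ℝ in 𝓝 t, |x| < n + 1 := (continuous_abs.tendsto t).eventually (gt_mem_nhds hn')
    filter_upwards [this] with x hx using key n x hx
  refine HasDerivAt.congr_of_eventuallyEq ?_ hev
  simp only [key n t hn']
  exact hθ n t (abs_lt.1 hn')

/-- `y` solves `y'' + q y = 0` on the line and has derivative `y'`. -/
def IsSolution (q y y' : ℝ → ℝ) : Prop :=
  ∀ t, HasDerivAt y (y' t) t ∧ HasDerivAt y' (-q t * y t) t

theorem exists_isSolution {q : ℝ → ℝ} (hq : Continuous q) (θ₀ : ℝ) :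
    ∃ y y' : ℝ → ℝ, IsSolution q y y' ∧ y 0 = Real.sin θ₀ ∧ y' 0 = Real.cos θ₀ := by
  obtain ⟨θ, h0, hθ⟩ := exists_pruefer_angle hq θ₀
  have hcont : Continuous θ := continuous_iff_continuousAt.2 fun t ↦ (hθ t).continuousAt
  let h : ℝ → ℝ := fun t ↦ (1 - q t) * Real.sin (θ t) * Real.cos (θ t)
  have hh : Continuous h := by fun_prop
  let ρ : ℝ → ℝ := fun t ↦ Real.exp (∫ x in (0 : ℝ)..t, h x)
  have hρ (t : ℝ) : HasDerivAt ρ (ρ t * h t) t :=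
    (hh.integral_hasStrictDerivAt 0 t).hasDerivAt.exp
  refine ⟨fun t ↦ ρ t * Real.sin (θ t), fun t ↦ ρ t * Real.cos (θ t), fun t ↦ ⟨?_, ?_⟩, ?_, ?_⟩
  · refine ((hρ t).mul (hθ t).sin).congr_deriv ?_
    simp only [prueferField, h]
    ring
  · refine ((hρ t).mul (hθ t).cos).congr_deriv ?_
    simp only [prueferField, h]
    linear_combination -(ρ t * Real.sin (θ t) * (q t - 1)) * Real.sin_sq_add_cos_sq (θ t)
  · simp [ρ, h0]
  · simp [ρ, h0]

theorem IsSolution.wronskian_eq {q y y' z z' : ℝ → ℝ} (hy : IsSolution q y y')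
    (hz : IsSolution q z z') (s t : ℝ) : y t * z' t - y' t * z t = y s * z' s - y' s * z s := by
  have h (x : ℝ) : HasDerivAt (fun t ↦ y t * z' t - y' t * z t) 0 x := by
    refine (((hy x).1.mul (hz x).2).sub ((hy x).2.mul (hz x).1)).congr_deriv ?_
    ring
  exact is_const_of_deriv_eq_zero (fun x ↦ (h x).differentiableAt) (fun x ↦ (h x).deriv) t s

theorem IsSolution.continuous {q y y' : ℝ → ℝ} (hy : IsSolution q y y') : Continuous y :=
  continuous_iff_continuousAt.2 fun t ↦ (hy t).1.continuousAt

theorem IsSolution.continuous' {q y y' : ℝ → ℝ} (hy : IsSolution q y y') : Continuous y' :=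
  continuous_iff_continuousAt.2 fun t ↦ (hy t).2.continuousAt

/-- A fundamental system of `y'' + q y = 0` with Wronskian `1`, together with its polar
coordinates. -/
structure PolarSystem (q : ℝ → ℝ) where
  f : ℝ → ℝ
  f' : ℝ → ℝ
  g : ℝ → ℝ
  g' : ℝ → ℝ
  phase : ℝ → ℝ
  amp : ℝ → ℝ
  solf : IsSolution q f f'
  solg : IsSolution q g g'
  wronskian : ∀ t, f t * g' t - f' t * g t = 1
  amp_pos : ∀ t, 0 < amp t
  f_eq : ∀ t, f t = amp t * Real.cos (phase t)
  g_eq : ∀ t, g t = amp t * Real.sin (phase t)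
  hasDerivAt_phase : ∀ t, HasDerivAt phase (1 / amp t ^ 2) t

theorem nonempty_polarSystem {q : ℝ → ℝ} (hq : Continuous q) : Nonempty (PolarSystem q) := by
  obtain ⟨f, f', hf, hf0, hf'0⟩ := exists_isSolution hq (Real.pi / 2)
  obtain ⟨g, g', hg, hg0, hg'0⟩ := exists_isSolution hq 0
  simp only [Real.sin_pi_div_two, Real.cos_pi_div_two, Real.sin_zero, Real.cos_zero] at *
  have hw (t : ℝ) : f t * g' t - f' t * g t = 1 := by
    rw [hf.wronskian_eq hg 0 t, hf0, hf'0, hg0, hg'0]; norm_num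
  let N : ℝ → ℝ := fun t ↦ f t ^ 2 + g t ^ 2
  have hN (t : ℝ) : 0 < N t := by
    have h1 : 0 ≤ N t := by positivity
    rcases h1.lt_or_eq with h | h
    · exact h
    · have hf2 : f t = 0 := by nlinarith [sq_nonneg (f t), sq_nonneg (g t)]
      have hg2 : g t = 0 := by nlinarith [sq_nonneg (f t), sq_nonneg (g t)]
      have := hw t
      rw [hf2, hg2] at this
      norm_num at this
  have cf := hf.continuous
  have cg := hg.continuous
  have hinv : Continuous fun t ↦ 1 / N t :=
    continuous_const.div (by fun_prop) fun t ↦ (hN t).ne'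
  let α : ℝ → ℝ := fun t ↦ ∫ x in (0 : ℝ)..t, 1 / N x
  have hα (t : ℝ) : HasDerivAt α (1 / N t) t := (hinv.integral_hasStrictDerivAt 0 t).hasDerivAt
  have hα0 : α 0 = 0 := by simp [α]
  have dN (t : ℝ) : HasDerivAt N (2 * (f t * f' t + g t * g' t)) t := by
    refine (((hf t).1.pow 2).add ((hg t).1.pow 2)).congr_deriv ?_
    norm_num; ring
  -- `(Y, X)` is the vector `(f, g)` rotated by `-α`. It remains to see that `X = 0` and `Y > 0`;
  -- the first holds because `X² / N` is constant and vanishes at `0`.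
  let X : ℝ → ℝ := fun t ↦ g t * Real.cos (α t) - f t * Real.sin (α t)
  let Y : ℝ → ℝ := fun t ↦ f t * Real.cos (α t) + g t * Real.sin (α t)
  have dX (t : ℝ) : HasDerivAt X ((f t * f' t + g t * g' t) / N t * X t) t := by
    refine (((hg t).1.mul (hα t).cos).sub ((hf t).1.mul (hα t).sin)).congr_deriv ?_
    have := (hN t).ne'
    field_simp
    simp only [N, X]
    linear_combination (f t * Real.cos (α t) + g t * Real.sin (α t)) * hw t
  have hX (t : ℝ) : X t = 0 := by
    have h (x : ℝ) : HasDerivAt (fun t ↦ X t ^ 2 / N t) 0 x := by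
      refine (((dX x).pow 2).div (dN x) (hN x).ne').congr_deriv ?_
      have := (hN x).ne'
      field_simp
      simp only [Pi.pow_apply]
      push_cast
      ring
    have h2 := is_const_of_deriv_eq_zero (fun x ↦ (h x).differentiableAt) (fun x ↦ (h x).deriv) t 0
    have h3 : X 0 = 0 := by simp [X, hα0, hg0]
    simp only [h3] at h2
    have := (hN t).ne'
    field_simp at h2
    simpa using h2
  have hY2 (t : ℝ) : Y t ^ 2 = N t := by
    have := hX t
    simp only [X, Y, N] at this ⊢
    linear_combination (f t ^ 2 + g t ^ 2) * Real.sin_sq_add_cos_sq (α t)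
      - (g t * Real.cos (α t) - f t * Real.sin (α t)) * this
  have cα : Continuous α := continuous_iff_continuousAt.2 fun t ↦ (hα t).continuousAt
  have cY : Continuous Y := by fun_prop
  have hY (t : ℝ) : 0 < Y t := by
    by_contra! hneg
    have h0 : 0 ≤ Y 0 := by simp [Y, hα0, hf0]
    obtain ⟨c, hc⟩ := mem_range_of_exists_le_of_exists_ge cY ⟨t, hneg⟩ ⟨0, h0⟩
    have := hN c
    rw [← hY2, hc] at this
    norm_num at this
  refine ⟨⟨f, f', g, g', α, Y, hf, hg, hw, hY, fun t ↦ ?_, fun t ↦ ?_, fun t ↦ ?_⟩⟩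
  · have := hX t
    simp only [X, Y] at this ⊢
    linear_combination (-f t) * Real.sin_sq_add_cos_sq (α t) - Real.sin (α t) * this
  · have := hX t
    simp only [X, Y] at this ⊢
    linear_combination (-g t) * Real.sin_sq_add_cos_sq (α t) + Real.cos (α t) * this
  · rw [hY2]; exact hα t

end ExistenceODE

/-! ### Wronskian comparison, and zeros of solutions in terms of the phase. -/

section Comparison

/-- Two solutions with the same end points and no zeros in between have coefficients that agree
somewhere. -/
theorem exists_coeff_eq {q q₀ y y' φ φ' : ℝ → ℝ} {c d : ℝ} (hcd : c < d)
    (hy : IsSolution q y y')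
    (hφ : ∀ t ∈ Icc c d, HasDerivAt φ (φ' t) t ∧ HasDerivAt φ' (-q₀ t * φ t) t)
    (hyc : y c = 0) (hyd : y d = 0) (hφc : φ c = 0) (hφd : φ d = 0)
    (hy0 : ∀ t ∈ Ioo c d, y t ≠ 0) (hφ0 : ∀ t ∈ Ioo c d, φ t ≠ 0) :
    ∃ x ∈ Ioo c d, q x = q₀ x := by
  -- The Wronskian vanishes at both ends, so by Rolle its derivative `y φ (q - q₀)` vanishes inside.
  have hW (t : ℝ) (ht : t ∈ Icc c d) : HasDerivAt (fun t ↦ y t * φ' t - y' t * φ t)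
      (y t * φ t * (q t - q₀ t)) t := by
    refine (((hy t).1.mul (hφ t ht).2).sub ((hy t).2.mul (hφ t ht).1)).congr_deriv ?_
    ring
  obtain ⟨x, hx, h⟩ := exists_hasDerivAt_eq_zero hcd (HasDerivAt.continuousOn hW)
    (by simp [hyc, hyd, hφc, hφd]) fun t ht ↦ hW t (Ioo_subset_Icc_self ht)
  refine ⟨x, hx, ?_⟩
  have := mul_ne_zero (hy0 x hx) (hφ0 x hx)
  exact sub_eq_zero.1 ((mul_eq_zero.1 h).resolve_left this)

theorem IsSolution.comp_const_add {q y y' : ℝ → ℝ} (hy : IsSolution q y y') (s : ℝ) :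
    IsSolution (fun t ↦ q (s + t)) (fun t ↦ y (s + t)) (fun t ↦ y' (s + t)) :=
  fun t ↦ ⟨(hy (s + t)).1.comp_const_add s t, (hy (s + t)).2.comp_const_add s t⟩

/-- If the derivative of `G` is a positive multiple of the square of a nontrivial solution, then
`G` increases strictly. -/
theorem IsSolution.lt_of_hasDerivAt_mul_sq {q y y' G c : ℝ → ℝ} {a b : ℝ} (hab : a < b)
    (hy : IsSolution q y y') (hG : ∀ t, HasDerivAt G (c t * y t ^ 2) t)
    (hc : ∀ t ∈ Ioo a b, 0 < c t) (hyb : y' b ≠ 0) : G a < G b := by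
  have hmono : MonotoneOn G (Icc a b) := by
    refine monotoneOn_of_hasDerivWithinAt_nonneg (convex_Icc a b)
      (HasDerivAt.continuousOn fun t _ ↦ hG t) (fun t _ ↦ (hG t).hasDerivWithinAt) fun t ht ↦ ?_
    rw [interior_Icc] at ht
    have := hc t ht
    positivity
  by_contra! hle
  -- Without strict increase `G` is constant, so `y` vanishes on the interval, and then so does
  -- `y'`, up to the end point `b` by continuity.
  have hy0 : ∀ t ∈ Ioo a b, y t = 0 := by
    intro t ht
    have hev : G =ᶠ[𝓝 t] fun _ ↦ G a := by
      filter_upwards [Icc_mem_nhds ht.1 ht.2] with x hx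
      exact le_antisymm ((hmono hx (right_mem_Icc.2 hab.le) hx.2).trans hle)
        (hmono (left_mem_Icc.2 hab.le) hx hx.1)
    have := (hG t).unique ((hasDerivAt_const t (G a)).congr_of_eventuallyEq hev)
    simpa [(hc t ht).ne'] using this
  have hy'0 : Ioo a b ⊆ {t | y' t = 0} := by
    intro t ht
    have hev : y =ᶠ[𝓝 t] fun _ ↦ 0 := by
      filter_upwards [Ioo_mem_nhds ht.1 ht.2] with x hx using hy0 x hx
    exact (hy t).1.unique ((hasDerivAt_const t (0 : ℝ)).congr_of_eventuallyEq hev)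
  have hcl := closure_minimal hy'0 (isClosed_eq hy.continuous' continuous_const)
  rw [closure_Ioo hab.ne] at hcl
  exact hyb (hcl (right_mem_Icc.2 hab.le))

namespace PolarSystem

variable {q : ℝ → ℝ} (P : PolarSystem q)

/-- The solution with value `0` and derivative `1` at `s`. -/
def sol (s t : ℝ) : ℝ := P.f s * P.g t - P.g s * P.f t

/-- The derivative of `sol`. -/
def sol' (s t : ℝ) : ℝ := P.f s * P.g' t - P.g s * P.f' t

theorem isSolution_sol (s : ℝ) : IsSolution q (P.sol s) (P.sol' s) := fun t ↦ by
  constructor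
  · exact ((P.solg t).1.const_mul _).sub ((P.solf t).1.const_mul _)
  · refine (((P.solg t).2.const_mul _).sub ((P.solf t).2.const_mul _)).congr_deriv ?_
    simp only [sol]; ring

theorem sol_self (s : ℝ) : P.sol s s = 0 := by simp only [sol]; ring

theorem sol'_self (s : ℝ) : P.sol' s s = 1 := by
  have := P.wronskian s
  simp only [sol']; linarith

theorem sol_eq (s t : ℝ) :
    P.sol s t = P.amp s * P.amp t * Real.sin (P.phase t - P.phase s) := by
  rw [sol, P.f_eq, P.f_eq, P.g_eq, P.g_eq, Real.sin_sub]; ring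

theorem sol_eq_zero_iff {s t : ℝ} :
    P.sol s t = 0 ↔ ∃ n : ℤ, (n : ℝ) * Real.pi = P.phase t - P.phase s := by
  rw [sol_eq, mul_eq_zero, or_iff_right (mul_pos (P.amp_pos s) (P.amp_pos t)).ne',
    Real.sin_eq_zero_iff]

theorem sol_neg {s t : ℝ} (h0 : P.phase t < P.phase s) (h1 : P.phase s < P.phase t + Real.pi) :
    P.sol s t < 0 := by
  rw [sol_eq]
  refine mul_neg_of_pos_of_neg (mul_pos (P.amp_pos s) (P.amp_pos t)) ?_
  exact Real.sin_neg_of_neg_of_neg_pi_lt (by linarith) (by linarith)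

/-- At a zero `t` of `sol s`, constancy of the Wronskians with `f` and `g` gives `(f, g)(s) = sol' s
t • (f, g)(t)`; compare lengths. -/
theorem sol'_sq {s t : ℝ} (h : P.sol s t = 0) : P.sol' s t ^ 2 = P.amp s ^ 2 / P.amp t ^ 2 := by
  have ht := P.amp_pos t
  have hw := P.wronskian t
  have key (x : ℝ) : P.amp x ^ 2 = P.f x ^ 2 + P.g x ^ 2 := by
    rw [P.f_eq, P.g_eq]
    linear_combination (-P.amp x ^ 2) * Real.sin_sq_add_cos_sq (P.phase x)
  have h1 : P.sol' s t * P.f t = P.f s := by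
    simp only [sol, sol'] at h ⊢
    linear_combination P.f s * hw + P.f' t * h
  have h2 : P.sol' s t * P.g t = P.g s := by
    simp only [sol, sol'] at h ⊢
    linear_combination P.g s * hw + P.g' t * h
  rw [eq_div_iff (by positivity), key, key, ← h1, ← h2]
  ring

theorem strictMono_phase : StrictMono P.phase :=
  strictMono_of_hasDerivAt_pos P.hasDerivAt_phase fun t ↦ by
    have := P.amp_pos t
    positivity

theorem continuous_phase : Continuous P.phase :=
  continuous_iff_continuousAt.2 fun t ↦ (P.hasDerivAt_phase t).continuousAt

end PolarSystem

end Comparison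

/-! ### Bessel's equation in logarithmic variable: phase gaps and eigenvalue comparison. -/

section Bessel

/-- The coefficient of Bessel's equation of order `l` in the variable `t = log r`. -/
noncomputable def besselCoeff (l : ℕ) (t : ℝ) : ℝ := Real.exp (2 * t) - (l : ℝ) ^ 2

theorem continuous_besselCoeff (l : ℕ) : Continuous (besselCoeff l) := by
  unfold besselCoeff; fun_prop

theorem hasDerivAt_exp_two_mul (t : ℝ) :
    HasDerivAt (fun t ↦ Real.exp (2 * t)) (2 * Real.exp (2 * t)) t := by
  refine ((hasDerivAt_id t).const_mul 2).exp.congr_deriv ?_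
  simp; ring

theorem hasDerivAt_besselCoeff (l : ℕ) (t : ℝ) :
    HasDerivAt (besselCoeff l) (2 * Real.exp (2 * t)) t :=
  (hasDerivAt_exp_two_mul t).sub_const _

theorem besselCoeff_add (l : ℕ) (s t : ℝ) :
    besselCoeff l (s + t) = Real.exp (2 * s) * Real.exp t ^ 2 - (l : ℝ) ^ 2 := by
  rw [besselCoeff, mul_add, Real.exp_add, ← Real.exp_nat_mul]; norm_num

/-- A polar system for Bessel's equation of order `l`. -/
noncomputable def bessel (l : ℕ) : PolarSystem (besselCoeff l) :=
  Classical.choice (nonempty_polarSystem (continuous_besselCoeff l))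

/-- The increase of the Bessel phase from `s + b` to `s`. -/
noncomputable def phaseGap (l : ℕ) (s b : ℝ) : ℝ := (bessel l).phase s - (bessel l).phase (s + b)

theorem phaseGap_zero (l : ℕ) (s : ℝ) : phaseGap l s 0 = 0 := by simp [phaseGap]

theorem phaseGap_add (l : ℕ) (s b c : ℝ) :
    phaseGap l s (b + c) = phaseGap l s b + phaseGap l (s + b) c := by
  simp only [phaseGap, add_assoc]; ring

theorem strictAnti_phaseGap (l : ℕ) (s : ℝ) : StrictAnti (phaseGap l s) := fun b c hbc ↦ by
  have := (bessel l).strictMono_phase (show s + b < s + c by linarith)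
  simp only [phaseGap]; linarith

theorem continuous_phaseGap (l : ℕ) : Continuous fun p : ℝ × ℝ ↦ phaseGap l p.1 p.2 := by
  have := (bessel l).continuous_phase
  unfold phaseGap; fun_prop

theorem hasDerivAt_phaseGap (l : ℕ) (s b : ℝ) : HasDerivAt (fun s ↦ phaseGap l s b)
    (1 / (bessel l).amp s ^ 2 - 1 / (bessel l).amp (s + b) ^ 2) s :=
  ((bessel l).hasDerivAt_phase s).sub
    (((bessel l).hasDerivAt_phase (s + b)).comp_add_const s b)

/-- Comparison with the image of a sine under a Möbius transformation. -/
theorem exists_exp_eq (l : ℕ) {s c d : ℝ} (hcd : c < d)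
    (h : phaseGap l (s + d) (c - d) = Real.pi) (β : ℝ)
    (hβ : 0 < 1 + β * (Real.exp d - Real.exp c)) :
    ∃ x ∈ Ioo (Real.exp c) (Real.exp d), Real.exp (2 * s) = ((l : ℝ) ^ 2 - 1 / 4) / x ^ 2 +
      (Real.pi * (1 + β * (Real.exp d - Real.exp c)) / (Real.exp d - Real.exp c)) ^ 2 /
        (1 + β * (x - Real.exp c)) ^ 4 := by
  set A := Real.exp c with hA
  set B := Real.exp d with hB
  have hAB : A < B := Real.exp_lt_exp.2 hcd
  have hBA : 0 < B - A := sub_pos.2 hAB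
  set K := Real.pi * (1 + β * (B - A)) / (B - A) with hK
  have hKpos : 0 < K := by have := Real.pi_pos; positivity
  have hD {r : ℝ} (hr : r ∈ Icc A B) : 0 < 1 + β * (r - A) := by
    rcases le_total 0 β with h0 | h0
    · have := mul_nonneg h0 (sub_nonneg.2 hr.1)
      linarith
    · have : β * (B - A) ≤ β * (r - A) := mul_le_mul_of_nonpos_left (by linarith [hr.2]) h0
      linarith
  -- In `r = e^t` the function `w = D sin ψ` satisfies `w'' + (K²/D⁴) w = 0`, because `dψ/dr =
  -- K/D²`. The factor `m = r^(-1/2)` removes the first-order term and produces the `-1/4` in `q₀`.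
  -- The value of `K` makes `ψ` run from `0` to `π`.
  let D : ℝ → ℝ := fun t ↦ 1 + β * (Real.exp t - A)
  let ψ : ℝ → ℝ := fun t ↦ K * (Real.exp t - A) / D t
  let m : ℝ → ℝ := fun t ↦ Real.exp (-(1 / 2) * t)
  let φ : ℝ → ℝ := fun t ↦ m t * (D t * Real.sin (ψ t))
  let φ' : ℝ → ℝ := fun t ↦ m t * ((β * Real.exp t - D t / 2) * Real.sin (ψ t)
    + K * Real.exp t / D t * Real.cos (ψ t))
  let q₀ : ℝ → ℝ := fun t ↦ K ^ 2 * Real.exp t ^ 2 / D t ^ 4 - 1 / 4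
  have hmem {t : ℝ} (ht : t ∈ Icc c d) : Real.exp t ∈ Icc A B :=
    ⟨Real.exp_le_exp.2 ht.1, Real.exp_le_exp.2 ht.2⟩
  have hm (t : ℝ) : HasDerivAt m (m t * (-(1 / 2))) t := by
    refine ((hasDerivAt_id t).const_mul (-(1 / 2) : ℝ)).exp.congr_deriv ?_
    simp only [m, id, mul_one]
  have dD (t : ℝ) : HasDerivAt D (β * Real.exp t) t :=
    (((Real.hasDerivAt_exp t).sub_const A).const_mul β).const_add 1
  have dψ {t : ℝ} (ht : t ∈ Icc c d) : HasDerivAt ψ (K * Real.exp t / D t ^ 2) t := by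
    have hDt : D t ≠ 0 := (hD (hmem ht)).ne'
    refine ((((Real.hasDerivAt_exp t).sub_const A).const_mul K).div (dD t) hDt).congr_deriv ?_
    simp only [D] at hDt ⊢
    ring
  have dφ : ∀ t ∈ Icc c d, HasDerivAt φ (φ' t) t ∧ HasDerivAt φ' (-q₀ t * φ t) t := by
    intro t ht
    have hDt : D t ≠ 0 := (hD (hmem ht)).ne'
    have e := Real.hasDerivAt_exp t
    constructor
    · refine ((hm t).mul ((dD t).mul (dψ ht).sin)).congr_deriv ?_
      simp only [φ', Pi.mul_apply]
      field_simp
      ring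
    · refine ((hm t).mul ((((e.const_mul β).sub ((dD t).div_const 2)).mul (dψ ht).sin).add
        (((e.const_mul K).div (dD t) hDt).mul (dψ ht).cos))).congr_deriv ?_
      simp only [φ, q₀, Pi.add_apply, Pi.mul_apply, Pi.sub_apply, Pi.div_apply]
      field_simp
      ring
  have hψ {t : ℝ} (ht : t ∈ Ioo c d) : ψ t ∈ Ioo 0 Real.pi := by
    have h1 : A < Real.exp t := Real.exp_lt_exp.2 ht.1
    have h2 : Real.exp t < B := Real.exp_lt_exp.2 ht.2
    have hDt : 0 < 1 + β * (Real.exp t - A) := hD ⟨h1.le, h2.le⟩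
    have h1' : 0 < Real.exp t - A := sub_pos.2 h1
    refine ⟨by positivity, ?_⟩
    simp only [ψ, D, hK]
    rw [div_lt_iff₀ hDt, div_mul_eq_mul_div, div_lt_iff₀ hBA]
    have := Real.pi_pos
    have h3 : 0 < Real.pi * (B - Real.exp t) := mul_pos this (sub_pos.2 h2)
    nlinarith
  have hphase : (bessel l).phase (s + d) = (bessel l).phase (s + c) + Real.pi := by
    rw [phaseGap, show s + d + (c - d) = s + c by ring] at h
    linarith
  have hmono := (bessel l).strictMono_phase
  obtain ⟨x, hx, hxq⟩ := exists_coeff_eq (q₀ := q₀) hcd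
    (((bessel l).isSolution_sol (s + d)).comp_const_add s) dφ
    ((bessel l).sol_eq_zero_iff.2 ⟨-1, by rw [hphase]; push_cast; ring⟩)
    ((bessel l).sol_self _) (by simp [φ, ψ, ← hA])
    (by
      have : ψ d = Real.pi := by
        simp only [ψ, D, ← hB, hK]
        field_simp
      simp [φ, this])
    (fun t ht ↦ ((bessel l).sol_neg (hmono (by linarith [ht.2]))
      (by rw [hphase]; linarith [hmono (show s + c < s + t by linarith [ht.1])])).ne)
    fun t ht ↦ (mul_pos (Real.exp_pos _) (mul_pos (hD (hmem (Ioo_subset_Icc_self ht)))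
      (Real.sin_pos_of_mem_Ioo (hψ ht)))).ne'
  refine ⟨Real.exp x, ⟨Real.exp_lt_exp.2 hx.1, Real.exp_lt_exp.2 hx.2⟩, ?_⟩
  have hDx : 1 + β * (Real.exp x - A) ≠ 0 := (hD (hmem (Ioo_subset_Icc_self hx))).ne'
  rw [besselCoeff_add] at hxq
  simp only [q₀, D] at hxq
  have hex := (Real.exp_pos x).ne'
  rw [← mul_left_inj' (pow_ne_zero 2 hex), add_mul, div_mul_cancel₀ _ (pow_ne_zero 2 hex)]
  rw [mul_div_right_comm] at hxq
  linarith

/-- The case of a constant frequency in the variable `r`. -/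
theorem exists_exp_eq_const (l : ℕ) {s c d : ℝ} (hcd : c < d)
    (h : phaseGap l (s + d) (c - d) = Real.pi) :
    ∃ x ∈ Ioo (Real.exp c) (Real.exp d), Real.exp (2 * s) = ((l : ℝ) ^ 2 - 1 / 4) / x ^ 2 +
      Real.pi ^ 2 / (Real.exp d - Real.exp c) ^ 2 := by
  obtain ⟨x, hx, h⟩ := exists_exp_eq l hcd h 0 (by simp)
  exact ⟨x, hx, by simpa [div_pow] using h⟩

/-- Sturm comparison with `sin (π t / b)`: were the gap smaller than `π`, `sol s` would keep its
sign on `[s + b, s)`, and the monotone Wronskian would have the wrong sign at `b`. -/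
theorem pi_le_phaseGap (l : ℕ) {s b : ℝ} (hb : b < 0)
    (h : (l : ℝ) ^ 2 + (Real.pi / b) ^ 2 ≤ Real.exp (2 * (s + b))) :
    Real.pi ≤ phaseGap l s b := by
  by_contra! hlt
  set P := bessel l
  set ω := Real.pi / b with hω
  have hωb : ω * b = Real.pi := div_mul_cancel₀ _ hb.ne
  have hω0 : ω < 0 := div_neg_of_pos_of_neg Real.pi_pos hb
  have hmono := P.strictMono_phase
  have hy := (P.isSolution_sol s).comp_const_add s
  have hneg {t : ℝ} (ht : t ∈ Ico b 0) : P.sol s (s + t) < 0 := by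
    refine P.sol_neg (hmono (by linarith [ht.2])) ?_
    have h1 : P.phase (s + b) ≤ P.phase (s + t) := hmono.monotone (by linarith [ht.1])
    have h2 : P.phase s - P.phase (s + b) < Real.pi := hlt
    linarith
  let W : ℝ → ℝ := fun t ↦ P.sol s (s + t) * (ω * Real.cos (ω * t))
    - P.sol' s (s + t) * Real.sin (ω * t)
  have hid (t : ℝ) : HasDerivAt (fun t ↦ ω * t) ω t := by
    simpa using (hasDerivAt_id t).const_mul ω
  have hW (t : ℝ) : HasDerivAt W
      (P.sol s (s + t) * Real.sin (ω * t) * (besselCoeff l (s + t) - ω ^ 2)) t := by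
    refine (((hy t).1.mul ((hid t).cos.const_mul ω)).sub
      ((hy t).2.mul (hid t).sin)).congr_deriv ?_
    ring
  have hanti : AntitoneOn W (Icc b 0) := by
    refine antitoneOn_of_hasDerivWithinAt_nonpos (convex_Icc b 0)
      (HasDerivAt.continuousOn fun t _ ↦ hW t) (fun t _ ↦ (hW t).hasDerivWithinAt) fun t ht ↦ ?_
    rw [interior_Icc] at ht
    have h1 := hneg ⟨ht.1.le, ht.2⟩
    have h2 : 0 < Real.sin (ω * t) := by
      refine Real.sin_pos_of_pos_of_lt_pi (mul_pos_of_neg_of_neg hω0 ht.2) ?_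
      rw [← hωb]
      exact mul_lt_mul_of_neg_left ht.1 hω0
    have h3 : Real.exp (2 * (s + b)) ≤ Real.exp (2 * (s + t)) :=
      Real.exp_le_exp.2 (by linarith [ht.1])
    refine mul_nonpos_of_nonpos_of_nonneg (mul_nonpos_of_nonpos_of_nonneg h1.le h2.le) ?_
    rw [besselCoeff]
    linarith
  have hle := hanti (left_mem_Icc.2 hb.le) (right_mem_Icc.2 hb.le) hb.le
  have h0 : W 0 = 0 := by simp [W, P.sol_self]
  have hb' : W b = -(P.sol s (s + b) * ω) := by simp [W, hωb]
  rw [h0, hb'] at hle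
  have := mul_pos_of_neg_of_neg (hneg ⟨le_rfl, hb⟩) hω0
  linarith

end Bessel

/-! ### Bounds on the ratio of boundary derivatives by multiplier identities. -/

section BoundaryRatio

/-- The squared ratio of the derivatives at `s + b` and `s` of a solution that vanishes there. -/
noncomputable def boundaryRatio (l : ℕ) (s b : ℝ) : ℝ :=
  (bessel l).amp s ^ 2 / (bessel l).amp (s + b) ^ 2

theorem sol_eq_zero_of_phaseGap {l n : ℕ} {s b : ℝ} (h : phaseGap l s b = n * Real.pi) :
    (bessel l).sol s (s + b) = 0 := by
  refine (bessel l).sol_eq_zero_iff.2 ⟨-n, ?_⟩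
  simp only [phaseGap] at h
  push_cast
  linarith

/-- The energy `y'² + q y²` has derivative `q' y²` with `q' > 0`, and equals `y'²` at both zeros. -/
theorem boundaryRatio_lt_one {l n : ℕ} {s b : ℝ} (hb : b < 0)
    (h : phaseGap l s b = n * Real.pi) : boundaryRatio l s b < 1 := by
  have h0 := sol_eq_zero_of_phaseGap h
  have hy := (bessel l).isSolution_sol s
  have hG (t : ℝ) : HasDerivAt
      (fun t ↦ (bessel l).sol' s t ^ 2 + besselCoeff l t * (bessel l).sol s t ^ 2)
      (2 * Real.exp (2 * t) * (bessel l).sol s t ^ 2) t := by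
    refine (((hy t).2.pow 2).add
      ((hasDerivAt_besselCoeff l t).mul ((hy t).1.pow 2))).congr_deriv ?_
    simp only [Pi.pow_apply]
    push_cast
    ring
  have := hy.lt_of_hasDerivAt_mul_sq (show s + b < s by linarith) hG
    (fun t _ ↦ by positivity) (by rw [(bessel l).sol'_self]; norm_num)
  simp only [h0, (bessel l).sol_self, (bessel l).sol'_self, (bessel l).sol'_sq h0] at this
  norm_num at this
  exact this

/-- The multiplier identity for the weight `e ^ (-2t)`. -/
theorem hasDerivAt_multiplier {l : ℕ} {y y' : ℝ → ℝ} (hy : IsSolution (besselCoeff l) y y')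
    (t : ℝ) : HasDerivAt (fun t ↦ Real.exp (-2 * t) *
        (y' t ^ 2 + 2 * (y t * y' t) + (2 + besselCoeff l t) * y t ^ 2))
      (Real.exp (-2 * t) * (4 * ((l : ℝ) ^ 2 - 1) - 2 * Real.exp (2 * t)) * y t ^ 2) t := by
  have he : HasDerivAt (fun t ↦ Real.exp (-2 * t)) (Real.exp (-2 * t) * (-2)) t := by
    simpa using ((hasDerivAt_id t).const_mul (-2 : ℝ)).exp
  refine (he.mul ((((hy t).2.pow 2).add (((hy t).1.mul (hy t).2).const_mul 2)).add
    (((hasDerivAt_besselCoeff l t).const_add 2).mul ((hy t).1.pow 2)))).congr_deriv ?_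
  simp only [Pi.add_apply, Pi.mul_apply, Pi.pow_apply, besselCoeff]
  push_cast
  ring

/-- For `l = 1` the factor `4(l² - 1) - 2e^(2t)` in `hasDerivAt_multiplier` is negative everywhere,
so the multiplier quantity, which is `e^(-2t) y'²` at the zeros, decreases. -/
theorem exp_lt_boundaryRatio_one {n : ℕ} {s b : ℝ} (hb : b < 0)
    (h : phaseGap 1 s b = n * Real.pi) : Real.exp (2 * b) < boundaryRatio 1 s b := by
  have h0 := sol_eq_zero_of_phaseGap h
  have hy := (bessel 1).isSolution_sol s
  have hG (t : ℝ) := ((hasDerivAt_multiplier hy t).neg).congr_deriv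
    (show _ = (2 : ℝ) * (Real.exp (-2 * t) * Real.exp (2 * t)) * (bessel 1).sol s t ^ 2 by
      push_cast; ring)
  have := hy.lt_of_hasDerivAt_mul_sq (show s + b < s by linarith) hG
    (fun t _ ↦ by positivity) (by rw [(bessel 1).sol'_self]; norm_num)
  simp only [Pi.neg_apply, h0, (bessel 1).sol_self, (bessel 1).sol'_self,
    (bessel 1).sol'_sq h0] at this
  change _ < -(Real.exp (-2 * s) * _) at this
  rw [show -2 * (s + b) = -2 * s + -(2 * b) by ring, Real.exp_add, Real.exp_neg] at this
  have hs := Real.exp_pos (-2 * s)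
  have hb' := Real.exp_pos (2 * b)
  have h2 : Real.exp (-2 * s) * 1 <
      Real.exp (-2 * s) * ((Real.exp (2 * b))⁻¹ * boundaryRatio 1 s b) := by
    rw [boundaryRatio]; nlinarith
  have h3 := lt_of_mul_lt_mul_left h2 hs.le
  rwa [inv_mul_eq_div, lt_div_iff₀ hb', one_mul] at h3

/-- Here the same factor is positive on the whole interval, since `e^(2t) < e^(2s) ≤ 2(l² - 1)`, and
the inequality reverses. -/
theorem boundaryRatio_lt_exp {l n : ℕ} {s b : ℝ} (hb : b < 0)
    (hs : Real.exp (2 * s) ≤ 2 * ((l : ℝ) ^ 2 - 1))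
    (h : phaseGap l s b = n * Real.pi) : boundaryRatio l s b < Real.exp (2 * b) := by
  have h0 := sol_eq_zero_of_phaseGap h
  have hy := (bessel l).isSolution_sol s
  have := hy.lt_of_hasDerivAt_mul_sq (show s + b < s by linarith) (hasDerivAt_multiplier hy)
    (fun t ht ↦ by
      have h1 : Real.exp (2 * t) < Real.exp (2 * s) := Real.exp_lt_exp.2 (by linarith [ht.2])
      exact mul_pos (Real.exp_pos _) (by linarith))
    (by rw [(bessel l).sol'_self]; norm_num)
  simp only [h0, (bessel l).sol_self, (bessel l).sol'_self, (bessel l).sol'_sq h0] at this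
  rw [show -2 * (s + b) = -2 * s + -(2 * b) by ring, Real.exp_add, Real.exp_neg] at this
  have hs := Real.exp_pos (-2 * s)
  have hb' := Real.exp_pos (2 * b)
  have h2 : Real.exp (-2 * s) * ((Real.exp (2 * b))⁻¹ * boundaryRatio l s b) <
      Real.exp (-2 * s) * 1 := by
    rw [boundaryRatio]; nlinarith
  have h3 := lt_of_mul_lt_mul_left h2 hs.le
  rwa [inv_mul_eq_div, div_lt_iff₀ hb', one_mul] at h3

end BoundaryRatio

/-! ### The eigenvalue branches: existence, uniqueness, continuity and derivative. -/

section EigenLog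

variable {l n : ℕ} {s b : ℝ}

theorem deriv_phaseGap_pos (hb : b < 0) (h : phaseGap l s b = n * Real.pi) :
    0 < 1 / (bessel l).amp s ^ 2 - 1 / (bessel l).amp (s + b) ^ 2 := by
  have h1 := boundaryRatio_lt_one hb h
  have p1 := (bessel l).amp_pos s
  have p2 := (bessel l).amp_pos (s + b)
  rw [boundaryRatio, div_lt_one (by positivity)] at h1
  exact sub_pos.2 (one_div_lt_one_div_of_lt (by positivity) h1)

/-- The phase gap crosses multiples of `π` upwards only. -/
theorem lt_phaseGap_of_lt {s' : ℝ} (hb : b < 0) (h : phaseGap l s b = n * Real.pi)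
    (hs : s < s') : n * Real.pi < phaseGap l s' b := by
  have hcont : Continuous fun s ↦ phaseGap l s b :=
    (continuous_phaseGap l).comp (continuous_id.prodMk continuous_const)
  have hge : ∀ x ∈ Icc s s', n * Real.pi ≤ phaseGap l x b := by
    intro x hx
    have := image_le_of_deriv_right_lt_deriv_boundary (f := fun x ↦ -phaseGap l x b)
      (B := fun _ ↦ -(n * Real.pi)) (B' := fun _ ↦ 0) (a := s) (b := s') hcont.neg.continuousOn
      (fun x _ ↦ (hasDerivAt_phaseGap l x b).neg.hasDerivWithinAt) (by simp [h])
      (fun x ↦ hasDerivAt_const x _)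
      (fun x _ hx ↦ neg_neg_of_pos (deriv_phaseGap_pos hb (neg_injective hx))) hx
    simpa using this
  -- Equality at `s'` would, by the positive derivative there, put the gap below `nπ` just to the
  -- left.
  refine (hge s' (right_mem_Icc.2 hs.le)).lt_of_ne' fun heq ↦ ?_
  have hd := deriv_phaseGap_pos hb heq
  have hslope := (hasDerivAt_iff_tendsto_slope.1 (hasDerivAt_phaseGap l s' b)).mono_left
    (nhdsWithin_mono s' (show Iio s' ⊆ {s'}ᶜ from fun x hx ↦ ne_of_lt hx))
  obtain ⟨x, hx, hxs⟩ := ((hslope.eventually (lt_mem_nhds hd)).and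
    (Ioo_mem_nhdsLT hs)).exists
  rw [slope_def_field, heq] at hx
  have := (div_pos_iff.1 hx).resolve_left fun h ↦ by linarith [hxs.2]
  linarith [hge x ⟨hxs.1.le, hxs.2.le⟩]

/-- Induction on `n` with `b` halved: the half next to `s` contributes `nπ`, and the other half one
more `π` once `s` is large. -/
theorem exists_le_phaseGap (l n : ℕ) (hb : b < 0) :
    ∃ S, ∀ s, S ≤ s → n * Real.pi ≤ phaseGap l s b := by
  induction n generalizing b with
  | zero =>
    refine ⟨0, fun s _ ↦ ?_⟩
    have := strictAnti_phaseGap l s hb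
    rw [phaseGap_zero] at this
    simpa using this.le
  | succ n ih =>
    have hb2 : b / 2 < 0 := by linarith
    obtain ⟨S, hS⟩ := ih hb2
    set M := (l : ℝ) ^ 2 + (Real.pi / (b / 2)) ^ 2
    refine ⟨max S (M - b), fun s hs ↦ ?_⟩
    have h1 := hS s ((le_max_left _ _).trans hs)
    have h2 : Real.pi ≤ phaseGap l (s + b / 2) (b / 2) := by
      refine pi_le_phaseGap l hb2 ?_
      have h3 : M ≤ s + b := by linarith [(le_max_right S (M - b)).trans hs]
      have h4 : 0 ≤ M := by positivity
      rw [show s + b / 2 + b / 2 = s + b by ring]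
      have h5 : M ≤ Real.exp (2 * (s + b)) := by linarith [Real.add_one_le_exp (2 * (s + b))]
      exact h5
    rw [show b = b / 2 + b / 2 by ring, phaseGap_add]
    push_cast
    linarith

theorem one_sub_exp_pos {c : ℝ} (hc : c < 0) : 0 < 1 - Real.exp c :=
  sub_pos.2 (Real.exp_lt_one_iff.2 hc)

/-- A first eigenvalue exceeds `l ^ 2`. -/
theorem sq_lt_exp_of_phaseGap_eq_pi (hl : 1 ≤ l) {c : ℝ} (hc : c < 0)
    (h : phaseGap l s c = Real.pi) : (l : ℝ) ^ 2 < Real.exp (2 * s) := by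
  obtain ⟨x, hx, heq⟩ := exists_exp_eq_const l (s := s) (c := c) (d := 0) hc (by simpa using h)
  rw [Real.exp_zero] at hx heq
  have hl' : (1 : ℝ) ≤ l := by exact_mod_cast hl
  have hx0 : 0 < x := (Real.exp_pos c).trans hx.1
  have h1 : (l : ℝ) ^ 2 - 1 / 4 ≤ ((l : ℝ) ^ 2 - 1 / 4) / x ^ 2 := by
    rw [le_div_iff₀ (by positivity)]
    have : x ^ 2 ≤ 1 := pow_le_one₀ hx0.le hx.2.le
    exact mul_le_of_le_one_right (by nlinarith) this
  have h2 : 9 ≤ Real.pi ^ 2 / (1 - Real.exp c) ^ 2 := by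
    have h3 := one_sub_exp_pos hc
    rw [le_div_iff₀ (by positivity)]
    have : (1 - Real.exp c) ^ 2 ≤ 1 := pow_le_one₀ h3.le (by linarith [Real.exp_pos c])
    nlinarith [Real.pi_gt_three]
  linarith

theorem exists_phaseGap_eq_pi (hb : b < 0) (h : Real.pi ≤ phaseGap l s b) :
    ∃ c ∈ Ico b 0, phaseGap l s c = Real.pi := by
  have hcont : Continuous (phaseGap l s) :=
    (continuous_phaseGap l).comp (continuous_const.prodMk continuous_id)
  obtain ⟨c, hc, hcπ⟩ := intermediate_value_Icc' hb.le hcont.continuousOn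
    ⟨(phaseGap_zero l s).le.trans Real.pi_pos.le, h⟩
  refine ⟨c, ⟨hc.1, hc.2.lt_of_ne ?_⟩, hcπ⟩
  rintro rfl
  rw [phaseGap_zero] at hcπ
  exact Real.pi_pos.ne hcπ

theorem phaseGap_lt_pi (hl : 1 ≤ l) (hb : b < 0) (hs : Real.exp (2 * s) ≤ (l : ℝ) ^ 2) :
    phaseGap l s b < Real.pi := by
  by_contra! hle
  obtain ⟨c, hc, h⟩ := exists_phaseGap_eq_pi hb hle
  exact (sq_lt_exp_of_phaseGap_eq_pi hl hc.2 h).not_ge hs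

theorem exists_phaseGap_eq (hl : 1 ≤ l) (hn : 1 ≤ n) (hb : b < 0) :
    ∃ s, phaseGap l s b = n * Real.pi := by
  have hcont : Continuous fun s ↦ phaseGap l s b :=
    (continuous_phaseGap l).comp (continuous_id.prodMk continuous_const)
  obtain ⟨S, hS⟩ := exists_le_phaseGap l n hb
  have hlow : phaseGap l 0 b ≤ n * Real.pi := by
    have h1 : phaseGap l 0 b < Real.pi := phaseGap_lt_pi hl hb (by
      have : (1 : ℝ) ≤ l := by exact_mod_cast hl
      norm_num
      linarith)
    have h2 : (1 : ℝ) ≤ n := by exact_mod_cast hn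
    nlinarith [Real.pi_pos]
  exact mem_range_of_exists_le_of_exists_ge hcont ⟨0, hlow⟩ ⟨S, hS S le_rfl⟩

/-- Half the logarithm of the `n`-th Dirichlet eigenvalue, counted from `1`, in mode `l` on the
annulus of radii `e ^ b` and `1`. -/
noncomputable def eigenLog (l n : ℕ) (b : ℝ) : ℝ :=
  Classical.epsilon fun s ↦ phaseGap l s b = n * Real.pi

theorem phaseGap_eigenLog (hl : 1 ≤ l) (hn : 1 ≤ n) (hb : b < 0) :
    phaseGap l (eigenLog l n b) b = n * Real.pi :=
  Classical.epsilon_spec (exists_phaseGap_eq hl hn hb)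

theorem lt_phaseGap_iff (hl : 1 ≤ l) (hn : 1 ≤ n) (hb : b < 0) :
    n * Real.pi < phaseGap l s b ↔ eigenLog l n b < s := by
  have h := phaseGap_eigenLog hl hn hb
  refine ⟨fun hlt ↦ ?_, lt_phaseGap_of_lt hb h⟩
  by_contra! hle
  rcases hle.eq_or_lt with rfl | hlt'
  · linarith
  · have hcont : Continuous fun s ↦ phaseGap l s b :=
      (continuous_phaseGap l).comp (continuous_id.prodMk continuous_const)
    obtain ⟨S, hS⟩ : ∃ S < s, phaseGap l S b ≤ n * Real.pi := by
      refine ⟨min (s - 1) 0, (min_le_left _ _).trans_lt (by linarith), ?_⟩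
      have h1 : phaseGap l (min (s - 1) 0) b < Real.pi := phaseGap_lt_pi hl hb (by
        have : (1 : ℝ) ≤ l := by exact_mod_cast hl
        have h2 : Real.exp (2 * min (s - 1) 0) ≤ 1 :=
          Real.exp_le_one_iff.2 (by linarith [min_le_right (s - 1) 0])
        nlinarith)
      have h2 : (1 : ℝ) ≤ n := by exact_mod_cast hn
      nlinarith [Real.pi_pos]
    obtain ⟨x, hx, hxn⟩ := intermediate_value_Icc hS.1.le hcont.continuousOn ⟨hS.2, hlt.le⟩
    have := lt_phaseGap_of_lt hb hxn (hx.2.trans_lt hlt')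
    linarith

theorem phaseGap_eq_iff (hl : 1 ≤ l) (hn : 1 ≤ n) (hb : b < 0) :
    phaseGap l s b = n * Real.pi ↔ s = eigenLog l n b := by
  refine ⟨fun h ↦ ?_, fun h ↦ h ▸ phaseGap_eigenLog hl hn hb⟩
  refine le_antisymm (not_lt.1 fun hlt ↦ ?_) (not_lt.1 fun hlt ↦ ?_)
  · linarith [(lt_phaseGap_iff hl hn hb).2 hlt]
  · linarith [lt_phaseGap_of_lt hb h hlt, phaseGap_eigenLog hl hn hb]

theorem phaseGap_lt_iff (hl : 1 ≤ l) (hn : 1 ≤ n) (hb : b < 0) :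
    phaseGap l s b < n * Real.pi ↔ s < eigenLog l n b := by
  rw [lt_iff_le_and_ne, ← not_lt, lt_phaseGap_iff hl hn hb, not_lt, Ne, phaseGap_eq_iff hl hn hb,
    ← Ne, ← lt_iff_le_and_ne]

theorem eigenLog_lt_eigenLog (hl : 1 ≤ l) (hn : 1 ≤ n) {m : ℕ} (hnm : n < m) (hb : b < 0) :
    eigenLog l n b < eigenLog l m b := by
  rw [← lt_phaseGap_iff hl hn hb, phaseGap_eigenLog hl (hn.trans hnm.le) hb]
  exact mul_lt_mul_of_pos_right (by exact_mod_cast hnm) Real.pi_pos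

theorem eigenLog_mono (hl : 1 ≤ l) (hn : 1 ≤ n) {b' : ℝ} (hb : b ≤ b') (hb' : b' < 0) :
    eigenLog l n b ≤ eigenLog l n b' := by
  refine not_lt.1 fun hlt ↦ ?_
  have h1 := (phaseGap_lt_iff hl hn (hb.trans_lt hb')).2 hlt
  have h2 := (strictAnti_phaseGap l (eigenLog l n b')).antitone hb
  rw [phaseGap_eigenLog hl hn hb'] at h2
  linarith

theorem sq_lt_exp_eigenLog (hl : 1 ≤ l) (hb : b < 0) :
    (l : ℝ) ^ 2 < Real.exp (2 * eigenLog l 1 b) :=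
  sq_lt_exp_of_phaseGap_eq_pi hl hb (by simpa using phaseGap_eigenLog hl le_rfl hb)

theorem continuousAt_eigenLog (hl : 1 ≤ l) (hn : 1 ≤ n) (hb : b < 0) :
    ContinuousAt (eigenLog l n) b := by
  have hcont (s : ℝ) : Continuous (phaseGap l s) :=
    (continuous_phaseGap l).comp (continuous_const.prodMk continuous_id)
  refine tendsto_order.2 ⟨fun s hs ↦ ?_, fun s hs ↦ ?_⟩
  · have h := (phaseGap_lt_iff hl hn hb).2 hs
    filter_upwards [(hcont s).continuousAt.eventually (gt_mem_nhds h), gt_mem_nhds hb]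
      with x hx hx0 using (phaseGap_lt_iff hl hn hx0).1 hx
  · have h := (lt_phaseGap_iff hl hn hb).2 hs
    filter_upwards [(hcont s).continuousAt.eventually (lt_mem_nhds h), gt_mem_nhds hb]
      with x hx hx0 using (lt_phaseGap_iff hl hn hx0).1 hx

/-- Implicit differentiation of `phaseGap l (σ x) x = nπ`. Difference quotients of the phase
(`dslope`) make continuity of `σ` sufficient. -/
theorem hasDerivAt_eigenLog (hl : 1 ≤ l) (hn : 1 ≤ n) (hb : b < 0) :
    HasDerivAt (eigenLog l n) (boundaryRatio l (eigenLog l n b) b /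
      (1 - boundaryRatio l (eigenLog l n b) b)) b := by
  set σ := eigenLog l n with hσ
  set P := bessel l with hP
  have hgap := phaseGap_eigenLog hl hn hb
  have hσc : ContinuousAt σ b := continuousAt_eigenLog hl hn hb
  have hpos := deriv_phaseGap_pos hb hgap
  have hd (t : ℝ) : ContinuousAt (dslope P.phase t) t :=
    continuousAt_dslope_same.2 (P.hasDerivAt_phase t).differentiableAt
  have hd0 (t : ℝ) : dslope P.phase t t = 1 / P.amp t ^ 2 := by
    rw [dslope_same, (P.hasDerivAt_phase t).deriv]
  have h1 : Tendsto (fun x ↦ dslope P.phase (σ b) (σ x)) (𝓝 b) (𝓝 (1 / P.amp (σ b) ^ 2)) := by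
    rw [← hd0]
    exact (hd (σ b)).tendsto.comp hσc
  have h2 : Tendsto (fun x ↦ dslope P.phase (σ b + b) (σ x + x)) (𝓝 b)
      (𝓝 (1 / P.amp (σ b + b) ^ 2)) := by
    rw [← hd0]
    exact (hd (σ b + b)).tendsto.comp (hσc.add continuousAt_id)
  have key : ∀ᶠ x in 𝓝 b, (dslope P.phase (σ b) (σ x) - dslope P.phase (σ b + b) (σ x + x)) *
      (σ x - σ b) = dslope P.phase (σ b + b) (σ x + x) * (x - b) := by
    filter_upwards [gt_mem_nhds hb] with x hx
    have e1 := sub_smul_dslope P.phase (σ b) (σ x)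
    have e2 := sub_smul_dslope P.phase (σ b + b) (σ x + x)
    have e3 : phaseGap l (σ x) x = n * Real.pi := phaseGap_eigenLog hl hn hx
    simp only [smul_eq_mul] at e1 e2
    simp only [phaseGap, ← hσ] at e3 hgap
    linear_combination e1 - e2 + e3 - hgap
  have hlim := h2.div (h1.sub h2) hpos.ne'
  have p1 := P.amp_pos (σ b)
  have p2 := P.amp_pos (σ b + b)
  have hval : boundaryRatio l (σ b) b / (1 - boundaryRatio l (σ b) b) =
      1 / P.amp (σ b + b) ^ 2 / (1 / P.amp (σ b) ^ 2 - 1 / P.amp (σ b + b) ^ 2) := by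
    rw [boundaryRatio, ← hP]
    field_simp
  rw [hasDerivAt_iff_tendsto_slope, hval]
  refine (hlim.mono_left nhdsWithin_le_nhds).congr' ?_
  have hne := (h1.sub h2).eventually (lt_mem_nhds hpos)
  filter_upwards [nhdsWithin_le_nhds key, nhdsWithin_le_nhds hne, self_mem_nhdsWithin]
    with x hx hx' hxb
  have hxb' : x - b ≠ 0 := sub_ne_zero.2 hxb
  rw [slope_def_field, Pi.div_apply, div_eq_div_iff hx'.ne' hxb', ← hx]
  ring

end EigenLog

/-! ### Identification of the spectra with the phase condition. -/

section Spectra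

variable {l : ℕ} {a κ : ℝ} {u : ℝ → ℝ}

theorem eq_right_of_hasDerivAt_zero {F : ℝ → ℝ} {b : ℝ} (hc : ContinuousOn F (Icc a b))
    (hd : ∀ x ∈ Ioo a b, HasDerivAt F 0 x) {x : ℝ} (hx : x ∈ Icc a b) : F x = F b := by
  rcases hx.2.eq_or_lt with rfl | hlt
  · rfl
  · obtain ⟨c, -, h⟩ := exists_hasDerivAt_eq_slope F (fun _ ↦ 0) hlt
      (hc.mono (Icc_subset_Icc_left hx.1)) fun t ht ↦ hd t ⟨hx.1.trans_lt ht.1, ht.2⟩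
    rw [eq_comm, div_eq_zero_iff] at h
    rcases h with h | h <;> linarith

namespace IsRadialSolution

theorem continuousOn_derivWithin (h : IsRadialSolution l a κ u) (ha : a < 1) :
    ContinuousOn (derivWithin u (Icc a 1)) (Icc a 1) :=
  h.contDiffOn.continuousOn_derivWithin (uniqueDiffOn_Icc ha) (by norm_num)

theorem hasDerivAt (h : IsRadialSolution l a κ u) {r : ℝ} (hr : r ∈ Ioo a 1) :
    HasDerivAt u (derivWithin u (Icc a 1) r) r :=
  ((h.contDiffOn.differentiableOn (by norm_num)) r
    (Ioo_subset_Icc_self hr)).hasDerivWithinAt.hasDerivAt (Icc_mem_nhds hr.1 hr.2)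

theorem hasDerivAt_derivWithin (h : IsRadialSolution l a κ u) {r : ℝ} (hr : r ∈ Ioo a 1) :
    HasDerivAt (derivWithin u (Icc a 1)) ((l : ℝ) ^ 2 * u r / r ^ 2
      - derivWithin u (Icc a 1) r / r - κ * u r) r := by
  have hcd : ContDiffOn ℝ 1 (deriv u) (Ioo a 1) :=
    ((contDiffOn_succ_iff_deriv_of_isOpen (n := 1) isOpen_Ioo).1
      (h.contDiffOn.mono Ioo_subset_Icc_self)).2.2
  have hd : HasDerivAt (deriv u) (deriv (deriv u) r) r :=
    ((hcd.differentiableOn (by norm_num)).differentiableAt (Ioo_mem_nhds hr.1 hr.2)).hasDerivAt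
  have hev : derivWithin u (Icc a 1) =ᶠ[𝓝 r] deriv u := by
    filter_upwards [Ioo_mem_nhds hr.1 hr.2] with x hx using (h.hasDerivAt hx).deriv.symm
  refine (hd.congr_of_eventuallyEq hev).congr_deriv ?_
  have := h.equation r hr
  rw [hev.eq_of_nhds]
  linarith

/-- The energy identity excludes eigenvalues for which the potential is positive. -/
theorem not_boundary (h : IsRadialSolution l a κ u) (ha : a ∈ Ioo (0 : ℝ) 1)
    (hκ : ∀ r ∈ Ioo a 1, 0 < (l : ℝ) ^ 2 / r - κ * r)
    (hua : u a * derivWithin u (Icc a 1) a = 0) (hu1 : u 1 * derivWithin u (Icc a 1) 1 = 0) :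
    False := by
  set v := derivWithin u (Icc a 1) with hv
  have hcu : ContinuousOn u (Icc a 1) := h.contDiffOn.continuousOn
  have hcv : ContinuousOn v (Icc a 1) := h.continuousOn_derivWithin ha.2
  let F : ℝ → ℝ := fun r ↦ u r * (r * v r)
  have hcF : ContinuousOn F (Icc a 1) := hcu.mul (continuousOn_id.mul hcv)
  -- This is `(r u u')' = r u'² + (l²/r - κ r) u²`, with `F` zero at both ends.
  have hF (r : ℝ) (hr : r ∈ Ioo a 1) :
      HasDerivAt F (r * v r ^ 2 + ((l : ℝ) ^ 2 / r - κ * r) * u r ^ 2) r := by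
    have hr0 : r ≠ 0 := (ha.1.trans hr.1).ne'
    refine ((h.hasDerivAt hr).mul ((hasDerivAt_id r).mul
      (h.hasDerivAt_derivWithin hr))).congr_deriv ?_
    simp only [id, Pi.mul_apply, ← hv]
    field_simp
    ring
  have hmono : MonotoneOn F (Icc a 1) := by
    refine monotoneOn_of_hasDerivWithinAt_nonneg (convex_Icc a 1) hcF
      (fun r hr ↦ (hF r (by rwa [interior_Icc] at hr)).hasDerivWithinAt) fun r hr ↦ ?_
    rw [interior_Icc] at hr
    have := hκ r hr
    have := ha.1.trans hr.1
    positivity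
  have hFa : F a = 0 := by simp only [F]; linear_combination a * hua
  have hF1 : F 1 = 0 := by simp only [F]; linear_combination hu1
  have hu0 : Ioo a 1 ⊆ {r | u r = 0} := by
    intro r hr
    have hev : F =ᶠ[𝓝 r] fun _ ↦ 0 := by
      filter_upwards [Icc_mem_nhds hr.1 hr.2] with x hx
      exact le_antisymm ((hmono hx (right_mem_Icc.2 ha.2.le) hx.2).trans hF1.le)
        (hFa.ge.trans (hmono (left_mem_Icc.2 ha.2.le) hx hx.1))
    have h1 := (hF r hr).unique ((hasDerivAt_const r (0 : ℝ)).congr_of_eventuallyEq hev)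
    have h2 := hκ r hr
    have h3 := ha.1.trans hr.1
    have h4 : 0 ≤ r * v r ^ 2 := by positivity
    have h5 : 0 ≤ ((l : ℝ) ^ 2 / r - κ * r) * u r ^ 2 := by positivity
    have h6 : ((l : ℝ) ^ 2 / r - κ * r) * u r ^ 2 = 0 := by linarith
    simpa [h2.ne'] using h6
  obtain ⟨r, hr, hne⟩ := h.nontrivial
  have heq : EqOn u (fun _ ↦ 0) (Icc a 1) := by
    have : EqOn u (fun _ ↦ 0) (Ioo a 1) := hu0
    exact this.of_subset_closure hcu continuousOn_const Ioo_subset_Icc_self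
      (by rw [closure_Ioo ha.2.ne])
  exact hne (heq hr)

end IsRadialSolution

theorem hasDerivAt_comp_log {y : ℝ → ℝ} {y₁ s r : ℝ} (hy : HasDerivAt y y₁ (s + Real.log r))
    (hr : 0 < r) : HasDerivAt (fun r ↦ y (s + Real.log r)) (y₁ / r) r :=
  HasDerivAt.comp r hy ((Real.hasDerivAt_log hr.ne').const_add s)

theorem continuousOn_comp_log {y : ℝ → ℝ} (hy : Continuous y) (s : ℝ) (ha : 0 < a) :
    ContinuousOn (fun r ↦ y (s + Real.log r)) (Icc a 1) :=
  hy.comp_continuousOn (continuousOn_const.add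
    (Real.continuousOn_log.mono fun _ hr ↦ (ha.trans_le hr.1).ne'))

theorem besselCoeff_add_log {s r : ℝ} (hr : 0 < r) :
    besselCoeff l (s + Real.log r) = Real.exp (2 * s) * r ^ 2 - (l : ℝ) ^ 2 := by
  rw [besselCoeff_add, Real.exp_log hr]

/-- A zero of the fundamental solution is a positive multiple of `π` for the phase gap. -/
theorem exists_phaseGap_of_sol_eq_zero {s b : ℝ} (hb : b < 0)
    (h : (bessel l).sol s (s + b) = 0) : ∃ n : ℕ, 1 ≤ n ∧ phaseGap l s b = n * Real.pi := by
  obtain ⟨m, hm⟩ := (bessel l).sol_eq_zero_iff.1 h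
  have h1 := (bessel l).strictMono_phase (show s + b < s by linarith)
  have h2 : (m : ℝ) < 0 := by nlinarith [Real.pi_pos]
  have h3 : m < 0 := by exact_mod_cast h2
  refine ⟨m.natAbs, by omega, ?_⟩
  have h4 : (m.natAbs : ℝ) = -m := by
    rw [Nat.cast_natAbs, abs_of_neg h3]; push_cast; rfl
  rw [phaseGap, h4]
  linarith

theorem IsSolution.contDiff {y y' : ℝ → ℝ} (hy : IsSolution (besselCoeff l) y y') :
    ContDiff ℝ 2 y ∧ ContDiff ℝ 2 y' := by
  have e1 : deriv y = y' := funext fun t ↦ (hy t).1.deriv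
  have e2 : deriv y' = fun t ↦ -besselCoeff l t * y t := funext fun t ↦ (hy t).2.deriv
  have d1 : Differentiable ℝ y := fun t ↦ (hy t).1.differentiableAt
  have d2 : Differentiable ℝ y' := fun t ↦ (hy t).2.differentiableAt
  have hq : ContDiff ℝ 1 (besselCoeff l) := by unfold besselCoeff; fun_prop
  have c1 : ContDiff ℝ 1 y := contDiff_one_iff_deriv.2 ⟨d1, e1 ▸ hy.continuous'⟩
  have c2 : ContDiff ℝ 1 y' := contDiff_one_iff_deriv.2
    ⟨d2, e2 ▸ (continuous_besselCoeff l).neg.mul hy.continuous⟩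
  have two : (2 : WithTop ℕ∞) = 1 + 1 := by norm_num
  constructor
  · rw [two, contDiff_succ_iff_deriv]
    exact ⟨d1, by simp, e1 ▸ c2⟩
  · rw [two, contDiff_succ_iff_deriv]
    exact ⟨d2, by simp, e2 ▸ hq.neg.mul c1⟩

theorem contDiffOn_comp_log {y : ℝ → ℝ} (hy : ContDiff ℝ 2 y) (s : ℝ) (ha : 0 < a) :
    ContDiffOn ℝ 2 (fun r ↦ y (s + Real.log r)) (Icc a 1) :=
  hy.comp_contDiffOn (contDiffOn_const.add
    (contDiffOn_id.log fun _ hr ↦ (ha.trans_le hr.1).ne'))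

theorem dirichletSpectrum_eq (hl : 1 ≤ l) (ha : a ∈ Ioo (0 : ℝ) 1) :
    dirichletSpectrum l a = {κ | ∃ s, ∃ n : ℕ, 1 ≤ n ∧
      phaseGap l s (Real.log a) = n * Real.pi ∧ Real.exp (2 * s) = κ} := by
  have hloga : Real.log a < 0 := Real.log_neg ha.1 ha.2
  ext κ
  constructor
  · rintro ⟨u, hu, hua, hu1⟩
    have hκ : 0 < κ := by
      by_contra! hκ
      refine hu.not_boundary ha (fun r hr ↦ ?_) (by simp [hua]) (by simp [hu1])
      have hr0 := ha.1.trans hr.1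
      have : (1 : ℝ) ≤ l := by exact_mod_cast hl
      have h1 : 0 < (l : ℝ) ^ 2 / r := by positivity
      nlinarith
    obtain ⟨s, rfl⟩ : ∃ s, Real.exp (2 * s) = κ :=
      ⟨Real.log κ / 2, by rw [mul_div_cancel₀ _ two_ne_zero, Real.exp_log hκ]⟩
    set v := derivWithin u (Icc a 1) with hv
    have hcu : ContinuousOn u (Icc a 1) := hu.contDiffOn.continuousOn
    have hcv : ContinuousOn v (Icc a 1) := hu.continuousOn_derivWithin ha.2
    -- The Wronskian of `u` with a solution of the logarithmic equation is constant on `[a, 1]`.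
    -- Taking `y = sol s`, which vanishes at `s`, gives the condition at `a`.
    have hX {y y' : ℝ → ℝ} (hy : IsSolution (besselCoeff l) y y') {x : ℝ} (hx : x ∈ Icc a 1) :
        u x * y' (s + Real.log x) - x * v x * y (s + Real.log x) = -v 1 * y s := by
      have := eq_right_of_hasDerivAt_zero (a := a) (b := 1)
        (F := fun r ↦ u r * y' (s + Real.log r) - r * v r * y (s + Real.log r))
        ((hcu.mul (continuousOn_comp_log hy.continuous' s ha.1)).sub
          ((continuousOn_id.mul hcv).mul (continuousOn_comp_log hy.continuous s ha.1)))
        (fun r hr ↦ by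
          have hr0 : 0 < r := ha.1.trans hr.1
          refine (((hu.hasDerivAt hr).mul (hasDerivAt_comp_log (hy _).2 hr0)).sub
            (((hasDerivAt_id r).mul (hu.hasDerivAt_derivWithin hr)).mul
              (hasDerivAt_comp_log (hy _).1 hr0))).congr_deriv ?_
          rw [besselCoeff_add_log hr0]
          simp only [id, Pi.mul_apply, ← hv]
          field_simp
          ring) hx
      rw [this, hu1, Real.log_one]
      simp
    have hP := (bessel l).isSolution_sol s
    have hXa := hX hP (left_mem_Icc.2 ha.2.le)
    rw [hua, (bessel l).sol_self] at hXa
    have hva : v a = 0 ∨ (bessel l).sol s (s + Real.log a) = 0 := by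
      have : a * (v a * (bessel l).sol s (s + Real.log a)) = 0 := by linarith
      exact mul_eq_zero.1 ((mul_eq_zero.1 this).resolve_left ha.1.ne')
    rcases hva with hva | h0
    · exfalso
      have hX0 {y y' : ℝ → ℝ} (hy : IsSolution (besselCoeff l) y y') {x : ℝ}
          (hx : x ∈ Icc a 1) :
          u x * y' (s + Real.log x) - x * v x * y (s + Real.log x) = 0 := by
        have h1 := hX hy (left_mem_Icc.2 ha.2.le)
        rw [hX hy hx, ← h1, hua, hva]
        ring
      obtain ⟨r, hr, hne⟩ := hu.nontrivial
      apply hne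
      linear_combination (bessel l).f (s + Real.log r) * hX0 (bessel l).solg hr
        - (bessel l).g (s + Real.log r) * hX0 (bessel l).solf hr
        - u r * (bessel l).wronskian (s + Real.log r)
    · obtain ⟨n, hn, h⟩ := exists_phaseGap_of_sol_eq_zero hloga h0
      exact ⟨s, n, hn, h, rfl⟩
  · rintro ⟨s, n, hn, h, rfl⟩
    have hP := (bessel l).isSolution_sol s
    have h0 := sol_eq_zero_of_phaseGap h
    have hd {r : ℝ} (hr : 0 < r) := hasDerivAt_comp_log (hP (s + Real.log r)).1 hr
    refine ⟨fun r ↦ (bessel l).sol s (s + Real.log r),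
      ⟨contDiffOn_comp_log hP.contDiff.1 s ha.1, fun r hr ↦ ?_, ?_⟩, h0, ?_⟩
    · have hr0 : 0 < r := ha.1.trans hr.1
      have hev : deriv (fun r ↦ (bessel l).sol s (s + Real.log r)) =ᶠ[𝓝 r]
          fun r ↦ (bessel l).sol' s (s + Real.log r) / r := by
        filter_upwards [lt_mem_nhds hr0] with x hx using (hd hx).deriv
      have hd2 : HasDerivAt (fun r ↦ (bessel l).sol' s (s + Real.log r) / r) _ r :=
        (hasDerivAt_comp_log (hP (s + Real.log r)).2 hr0).div (hasDerivAt_id' r) hr0.ne'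
      rw [hev.deriv_eq, hev.eq_of_nhds, hd2.deriv, besselCoeff_add_log hr0]
      field_simp
      ring
    · have h1 : HasDerivAt (fun r ↦ (bessel l).sol s (s + Real.log r)) 1 1 := by
        refine (hd one_pos).congr_deriv ?_
        simp [(bessel l).sol'_self]
      have h2 := (h1.eventually_ne (c := 0) one_ne_zero).filter_mono
        (nhdsWithin_mono 1 (show Iio (1 : ℝ) ⊆ {1}ᶜ from fun x hx ↦ ne_of_lt hx))
      obtain ⟨r, hr, hr'⟩ := (h2.and (Ioo_mem_nhdsLT ha.2)).exists
      exact ⟨r, Ioo_subset_Icc_self hr', hr⟩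
    · simp [(bessel l).sol_self]

/-- The derivative `v = u'` of a mode `0` solution satisfies the mode `1` equation, and the Neumann
conditions say that `v` vanishes at `a` and `1`. For `κ ≠ 0` one recovers `u` from `v' + v/r = -κ
u`; `κ = 0` comes from constants. -/
theorem neumannSpectrum_zero_eq (ha : a ∈ Ioo (0 : ℝ) 1) :
    neumannSpectrum 0 a = {κ | κ = 0 ∨ ∃ s, ∃ n : ℕ, 1 ≤ n ∧
      phaseGap 1 s (Real.log a) = n * Real.pi ∧ Real.exp (2 * s) = κ} := by
  have hloga : Real.log a < 0 := Real.log_neg ha.1 ha.2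
  ext κ
  constructor
  · rintro ⟨u, hu, hua, hu1⟩
    have hκ : 0 ≤ κ := by
      by_contra! hκ
      refine hu.not_boundary ha (fun r hr ↦ ?_) (by simp [hua]) (by simp [hu1])
      have hr0 := ha.1.trans hr.1
      norm_num
      nlinarith
    rcases hκ.eq_or_lt with rfl | hκ
    · exact Or.inl rfl
    right
    obtain ⟨s, rfl⟩ : ∃ s, Real.exp (2 * s) = κ :=
      ⟨Real.log κ / 2, by rw [mul_div_cancel₀ _ two_ne_zero, Real.exp_log hκ]⟩
    set κ := Real.exp (2 * s) with hκs
    set v := derivWithin u (Icc a 1) with hv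
    have hcu : ContinuousOn u (Icc a 1) := hu.contDiffOn.continuousOn
    have hcv : ContinuousOn v (Icc a 1) := hu.continuousOn_derivWithin ha.2
    -- The Wronskian `v y' - r v' y`, with `r v'` replaced by `-(v + κ r u)` so that no second
    -- derivative of `v` is needed.
    have hX {y y' : ℝ → ℝ} (hy : IsSolution (besselCoeff 1) y y') {x : ℝ} (hx : x ∈ Icc a 1) :
        v x * y' (s + Real.log x) + (v x + κ * (x * u x)) * y (s + Real.log x)
          = κ * u 1 * y s := by
      have hy0 := continuousOn_comp_log hy.continuous s ha.1
      have hy1 := continuousOn_comp_log hy.continuous' s ha.1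
      have := eq_right_of_hasDerivAt_zero (a := a) (b := 1)
        (F := fun r ↦ v r * y' (s + Real.log r) +
          (v r + κ * (r * u r)) * y (s + Real.log r))
        ((hcv.mul hy1).add ((hcv.add (continuousOn_const.mul (continuousOn_id.mul hcu))).mul hy0))
        (fun r hr ↦ by
          have hr0 : 0 < r := ha.1.trans hr.1
          have h1 := hu.hasDerivAt hr
          have h2 := hu.hasDerivAt_derivWithin hr
          refine ((h2.mul (hasDerivAt_comp_log (hy _).2 hr0)).add
            ((h2.add (((hasDerivAt_id r).mul h1).const_mul κ)).mul
              (hasDerivAt_comp_log (hy _).1 hr0))).congr_deriv ?_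
          rw [besselCoeff_add_log hr0, ← hκs]
          simp only [id, Pi.mul_apply, Pi.add_apply, ← hv]
          push_cast
          field_simp
          ring) hx
      rw [this, hu1, Real.log_one]
      simp
    have hP := (bessel 1).isSolution_sol s
    have hXa := hX hP (left_mem_Icc.2 ha.2.le)
    rw [hua, (bessel 1).sol_self] at hXa
    have hva : u a = 0 ∨ (bessel 1).sol s (s + Real.log a) = 0 := by
      have : (κ * a) * (u a * (bessel 1).sol s (s + Real.log a)) = 0 := by linarith
      exact mul_eq_zero.1 ((mul_eq_zero.1 this).resolve_left (mul_pos hκ ha.1).ne')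
    rcases hva with hva | h0
    · exfalso
      have hX0 {y y' : ℝ → ℝ} (hy : IsSolution (besselCoeff 1) y y') {x : ℝ}
          (hx : x ∈ Icc a 1) : v x * y' (s + Real.log x) +
            (v x + κ * (x * u x)) * y (s + Real.log x) = 0 := by
        have h1 := hX hy (left_mem_Icc.2 ha.2.le)
        rw [hX hy hx, ← h1, hua, hva]
        ring
      obtain ⟨r, hr, hne⟩ := hu.nontrivial
      have w := (bessel 1).wronskian (s + Real.log r)
      have hg := hX0 (bessel 1).solg hr
      have hf := hX0 (bessel 1).solf hr
      have hv0 : v r = 0 := by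
        linear_combination (bessel 1).f (s + Real.log r) * hg
          - (bessel 1).g (s + Real.log r) * hf - v r * w
      have hu0 : κ * r * u r = 0 := by
        linear_combination (-(bessel 1).f' (s + Real.log r)) * hg
          + (bessel 1).g' (s + Real.log r) * hf - (v r + κ * (r * u r)) * w - hv0
      exact hne ((mul_eq_zero.1 hu0).resolve_left (mul_pos hκ (ha.1.trans_le hr.1)).ne')
    · obtain ⟨n, hn, h⟩ := exists_phaseGap_of_sol_eq_zero hloga h0
      exact ⟨s, n, hn, h, rfl⟩
  · rintro (rfl | ⟨s, n, hn, h, rfl⟩)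
    · refine ⟨fun _ ↦ 1, ⟨contDiffOn_const, fun r _ ↦ ?_, ⟨1, right_mem_Icc.2 ha.2.le, one_ne_zero⟩⟩,
        by simp, by simp⟩
      simp
    set κ := Real.exp (2 * s) with hκs
    have hκ : 0 < κ := Real.exp_pos _
    have hP := (bessel 1).isSolution_sol s
    have h0 := sol_eq_zero_of_phaseGap h
    have hd {r : ℝ} (hr : 0 < r) := hasDerivAt_comp_log (hP (s + Real.log r)).1 hr
    have hd' {r : ℝ} (hr : 0 < r) := hasDerivAt_comp_log (hP (s + Real.log r)).2 hr
    let u : ℝ → ℝ := fun r ↦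
      ((bessel 1).sol' s (s + Real.log r) + (bessel 1).sol s (s + Real.log r)) / (-κ * r)
    have hu {r : ℝ} (hr : 0 < r) : HasDerivAt u ((bessel 1).sol s (s + Real.log r)) r := by
      refine (((hd' hr).add (hd hr)).div ((hasDerivAt_id r).const_mul (-κ))
        (mul_ne_zero (neg_ne_zero.2 hκ.ne') hr.ne')).congr_deriv ?_
      rw [besselCoeff_add_log hr, ← hκs]
      simp only [id, Pi.add_apply]
      push_cast
      field_simp
      ring
    have hw {r : ℝ} (hr : r ∈ Icc a 1) :
        derivWithin u (Icc a 1) r = (bessel 1).sol s (s + Real.log r) :=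
      (hu (ha.1.trans_le hr.1)).hasDerivWithinAt.derivWithin (uniqueDiffOn_Icc ha.2 r hr)
    refine ⟨u, ⟨?_, fun r hr ↦ ?_, 1, right_mem_Icc.2 ha.2.le, ?_⟩, ?_, ?_⟩
    · exact ((contDiffOn_comp_log hP.contDiff.2 s ha.1).add
        (contDiffOn_comp_log hP.contDiff.1 s ha.1)).div (contDiffOn_const.mul contDiffOn_id)
        fun r hr ↦ mul_ne_zero (neg_ne_zero.2 hκ.ne') (ha.1.trans_le hr.1).ne'
    · have hr0 : 0 < r := ha.1.trans hr.1
      have hev : deriv u =ᶠ[𝓝 r] fun r ↦ (bessel 1).sol s (s + Real.log r) := by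
        filter_upwards [lt_mem_nhds hr0] with x hx using (hu hx).deriv
      rw [hev.deriv_eq, hev.eq_of_nhds, (hd hr0).deriv]
      simp only [u]
      push_cast
      field_simp
      ring
    · simp [u, (bessel 1).sol_self, (bessel 1).sol'_self, hκ.ne']
    · rw [hw (left_mem_Icc.2 ha.2.le), h0]
    · rw [hw (right_mem_Icc.2 ha.2.le), Real.log_one, add_zero, (bessel 1).sol_self]

theorem dirichletEigenvalue_eq (hl : 1 ≤ l) (n : ℕ) (ha : a ∈ Ioo (0 : ℝ) 1) :
    dirichletEigenvalue l n a = Real.exp (2 * eigenLog l (n + 1) (Real.log a)) := by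
  have hb : Real.log a < 0 := Real.log_neg ha.1 ha.2
  refine enum_eq_of_strictMono (e := fun n ↦ Real.exp (2 * eigenLog l (n + 1) (Real.log a)))
    (fun m n hmn ↦ ?_) ?_ n
  · have := eigenLog_lt_eigenLog hl (show 1 ≤ m + 1 by omega) (show m + 1 < n + 1 by omega) hb
    exact Real.exp_lt_exp.2 (by linarith)
  · rw [dirichletSpectrum_eq hl ha]
    ext κ
    constructor
    · rintro ⟨n, rfl⟩
      exact ⟨_, n + 1, by omega, phaseGap_eigenLog hl (by omega) hb, rfl⟩
    · rintro ⟨s, n, hn, h, rfl⟩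
      refine ⟨n - 1, ?_⟩
      simp only [Nat.sub_add_cancel hn, ← (phaseGap_eq_iff hl hn hb).1 h]

/-- The eigenvalue `0` takes index `0`, while `eigenLog` counts from `1`; hence the same index on
both sides here, against a shift in `dirichletEigenvalue_eq`. -/
theorem neumannEigenvalue_zero_succ_eq (n : ℕ) (ha : a ∈ Ioo (0 : ℝ) 1) :
    neumannEigenvalue 0 (n + 1) a = Real.exp (2 * eigenLog 1 (n + 1) (Real.log a)) := by
  have hb : Real.log a < 0 := Real.log_neg ha.1 ha.2
  let e : ℕ → ℝ := fun n ↦ if n = 0 then 0 else Real.exp (2 * eigenLog 1 n (Real.log a))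
  have he (n : ℕ) (hn : 1 ≤ n) : e n = Real.exp (2 * eigenLog 1 n (Real.log a)) :=
    if_neg (by omega)
  rw [← he (n + 1) (by omega)]
  refine enum_eq_of_strictMono (e := e) (fun m n hmn ↦ ?_) ?_ (n + 1)
  · rcases Nat.eq_zero_or_pos m with rfl | hm
    · rw [he n hmn, show e 0 = 0 from if_pos rfl]
      exact Real.exp_pos _
    · rw [he m hm, he n (by omega)]
      have := eigenLog_lt_eigenLog le_rfl hm hmn hb
      exact Real.exp_lt_exp.2 (by linarith)
  · rw [neumannSpectrum_zero_eq ha]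
    ext κ
    constructor
    · rintro ⟨n, rfl⟩
      rcases Nat.eq_zero_or_pos n with rfl | hn
      · exact Or.inl (if_pos rfl)
      · exact Or.inr ⟨_, n, hn, phaseGap_eigenLog le_rfl hn hb, (he n hn).symm⟩
    · rintro (rfl | ⟨s, n, hn, h, rfl⟩)
      · exact ⟨0, if_pos rfl⟩
      · exact ⟨n, by rw [he n hn, ← (phaseGap_eq_iff le_rfl hn hb).1 h]⟩

end Spectra

/-! ### Quantitative eigenvalue bounds and asymptotics of the crossing. -/

section Bounds

variable {l : ℕ} {a : ℝ}

theorem exists_exp_eigenLog_one_eq (hl : 1 ≤ l) (ha : a ∈ Ioo (0 : ℝ) 1) (β : ℝ)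
    (hβ : 0 < 1 + β * (1 - a)) :
    ∃ x ∈ Ioo a 1, Real.exp (2 * eigenLog l 1 (Real.log a)) = ((l : ℝ) ^ 2 - 1 / 4) / x ^ 2 +
      (Real.pi * (1 + β * (1 - a)) / (1 - a)) ^ 2 / (1 + β * (x - a)) ^ 4 := by
  have hb : Real.log a < 0 := Real.log_neg ha.1 ha.2
  have h := phaseGap_eigenLog hl le_rfl hb
  have := exists_exp_eq l (s := eigenLog l 1 (Real.log a)) hb (by simpa using h) β
  rw [Real.exp_log ha.1, Real.exp_zero] at this
  exact this hβ

theorem exists_exp_eigenLog_one_eq_const (hl : 1 ≤ l) (ha : a ∈ Ioo (0 : ℝ) 1) :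
    ∃ x ∈ Ioo a 1, Real.exp (2 * eigenLog l 1 (Real.log a)) = ((l : ℝ) ^ 2 - 1 / 4) / x ^ 2 +
      Real.pi ^ 2 / (1 - a) ^ 2 := by
  obtain ⟨x, hx, h⟩ := exists_exp_eigenLog_one_eq hl ha 0 (by simp)
  exact ⟨x, hx, by simpa [div_pow] using h⟩

/-- The interior node splits `(a, 1)` into two nodal intervals with the same eigenvalue. The one of
length at most `(1-a)/2` gives the lower bound, the other the upper bound. -/
theorem exp_eigenLog_two_mem_Icc (ha : a ∈ Ioo (0 : ℝ) 1) :
    Real.exp (2 * eigenLog 1 2 (Real.log a)) ∈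
      Icc (4 * Real.pi ^ 2 / (1 - a) ^ 2 + 3 / 4)
        (4 * Real.pi ^ 2 / (1 - a) ^ 2 + 3 / 4 / a ^ 2) := by
  have hb : Real.log a < 0 := Real.log_neg ha.1 ha.2
  set b := Real.log a with hba
  have hea : Real.exp b = a := Real.exp_log ha.1
  have h : phaseGap 1 (eigenLog 1 2 b) b = 2 * Real.pi := by
    simpa using phaseGap_eigenLog (l := 1) (n := 2) le_rfl (by norm_num) hb
  set s := eigenLog 1 2 b
  have hpi := Real.pi_pos
  obtain ⟨c, hc, hcπ⟩ := exists_phaseGap_eq_pi hb (by rw [h]; linarith)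
  have hbc : b < c := hc.1.lt_of_ne (by rintro rfl; linarith)
  have hadd := phaseGap_add 1 s c (b - c)
  rw [show c + (b - c) = b by ring] at hadd
  obtain ⟨x, hx, h1⟩ := exists_exp_eq_const 1 (s := s) hc.2 (by simpa using hcπ)
  obtain ⟨z, hz, h2⟩ := exists_exp_eq_const 1 (s := s) hbc (by linarith)
  rw [Real.exp_zero] at hx h1
  rw [hea] at hz h2
  set m := Real.exp c
  have ham : a < m := hz.1.trans hz.2
  have hm1 : m < 1 := hx.1.trans hx.2
  norm_num at h1 h2
  have hq {x : ℝ} (hxa : a < x) (hx1 : x < 1) : 3 / 4 ≤ 3 / 4 / x ^ 2 ∧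
      3 / 4 / x ^ 2 ≤ 3 / 4 / a ^ 2 := by
    have hx0 := ha.1.trans hxa
    constructor
    · rw [le_div_iff₀ (by positivity)]
      have : x ^ 2 ≤ 1 := pow_le_one₀ hx0.le hx1.le
      linarith
    · have := ha.1
      gcongr
  have hq1 := hq (ham.trans hx.1) hx.2
  have hq2 := hq hz.1 (hz.2.trans hm1)
  have key {t : ℝ} (ht : 0 < t) :
      (t ≤ (1 - a) / 2 → 4 * Real.pi ^ 2 / (1 - a) ^ 2 ≤ Real.pi ^ 2 / t ^ 2) ∧
      ((1 - a) / 2 ≤ t → Real.pi ^ 2 / t ^ 2 ≤ 4 * Real.pi ^ 2 / (1 - a) ^ 2) := by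
    have hδ : 0 < 1 - a := sub_pos.2 ha.2
    have e : 4 * Real.pi ^ 2 / (1 - a) ^ 2 = Real.pi ^ 2 / ((1 - a) / 2) ^ 2 := by
      field_simp
      norm_num
    rw [e]
    constructor <;> intro h <;> gcongr
  have k1 := key (sub_pos.2 hm1)
  have k2 := key (sub_pos.2 ham)
  rcases le_total (1 - m) ((1 - a) / 2) with hle | hle
  · have := k1.1 hle
    have := k2.2 (by linarith)
    constructor <;> linarith
  · have := k1.2 hle
    have := k2.1 (by linarith)
    constructor <;> linarith

theorem sq_pi_lt_ten : Real.pi ^ 2 < 10 := by nlinarith [Real.pi_lt_d2, Real.pi_gt_three]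

theorem nine_lt_sq_pi : 9 < Real.pi ^ 2 := by nlinarith [Real.pi_gt_three]

/-- By monotonicity the worst case is `a = 1/2`, where the bound is `16π² + 3 < 163`. -/
theorem exp_eigenLog_two_lt_of_le_half (ha : a ∈ Ioo (0 : ℝ) 1) (ha2 : a ≤ 1 / 2) :
    Real.exp (2 * eigenLog 1 2 (Real.log a)) < 163 := by
  have h1 := (exp_eigenLog_two_mem_Icc (a := 1 / 2) ⟨by norm_num, by norm_num⟩).2
  have h2 : eigenLog 1 2 (Real.log a) ≤ eigenLog 1 2 (Real.log (1 / 2)) :=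
    eigenLog_mono le_rfl (by norm_num) (Real.log_le_log ha.1 ha2)
      (Real.log_neg (by norm_num) (by norm_num))
  have h3 := Real.exp_le_exp.2 (show 2 * eigenLog 1 2 (Real.log a) ≤
    2 * eigenLog 1 2 (Real.log (1 / 2)) by linarith)
  norm_num at h1
  linarith [sq_pi_lt_ten]

theorem half_lt_of_eigenLog_eq (hl : 13 ≤ l) (ha : a ∈ Ioo (0 : ℝ) 1)
    (h : eigenLog 1 2 (Real.log a) = eigenLog l 1 (Real.log a)) : 1 / 2 < a := by
  by_contra! hle
  have h1 := exp_eigenLog_two_lt_of_le_half ha hle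
  have h2 := sq_lt_exp_eigenLog (l := l) (by omega) (Real.log_neg ha.1 ha.2)
  have hl' : (13 : ℝ) ≤ l := by exact_mod_cast hl
  rw [h] at h1
  nlinarith

/-- A priori bound: the crossing forces `l² + π²/δ² ≤ 4π²/δ² + O(1)`, so `lδ` is bounded. -/
theorem mul_one_sub_le_of_eigenLog_eq (hl : 1000 ≤ l) (ha : a ∈ Ioo (0 : ℝ) 1)
    (h : eigenLog 1 2 (Real.log a) = eigenLog l 1 (Real.log a)) :
    (l : ℝ) ^ 2 * (1 - a) ^ 2 ≤ 60 ∧ l * (1 - a) ≤ 8 := by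
  have hl' : (1000 : ℝ) ≤ l := by exact_mod_cast hl
  have ha2 := half_lt_of_eigenLog_eq (by omega) ha h
  have hδ : 0 < 1 - a := sub_pos.2 ha.2
  have h1 := (exp_eigenLog_two_mem_Icc ha).2
  obtain ⟨x, hx, h2⟩ := exists_exp_eigenLog_one_eq_const (l := l) (by omega) ha
  have hx0 : 0 < x := ha.1.trans hx.1
  have h3 : (l : ℝ) ^ 2 - 1 / 4 ≤ ((l : ℝ) ^ 2 - 1 / 4) / x ^ 2 := by
    rw [le_div_iff₀ (by positivity)]
    exact mul_le_of_le_one_right (by nlinarith) (pow_le_one₀ hx0.le hx.2.le)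
  have h4 : 3 / 4 / a ^ 2 ≤ 3 := by
    rw [div_le_iff₀ (by nlinarith)]; nlinarith
  rw [h, h2] at h1
  have h5 : (l : ℝ) ^ 2 / 2 ≤ 3 * (Real.pi ^ 2 / (1 - a) ^ 2) := by
    rw [mul_div_assoc] at h1
    nlinarith
  rw [← mul_div_assoc, le_div_iff₀ (by positivity)] at h5
  have h6 : (l : ℝ) ^ 2 * (1 - a) ^ 2 ≤ 60 := by linarith [sq_pi_lt_ten]
  refine ⟨h6, ?_⟩
  nlinarith [mul_pos (show (0 : ℝ) < l by linarith) hδ]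

theorem abs_inv_sq_sub_le {w δ : ℝ} (hw : 0 ≤ w) (hwδ : w ≤ δ) (hδ : δ ≤ 1 / 100) :
    |1 / (1 - w) ^ 2 - (1 + 2 * w)| ≤ 4 * δ ^ 2 := by
  have h0 : 1 - w ≠ 0 := by linarith
  have h1 : 0 < (1 - w) ^ 2 := by positivity
  have h2 : 1 / (1 - w) ^ 2 - (1 + 2 * w) = w ^ 2 * (3 - 2 * w) / (1 - w) ^ 2 := by
    field_simp; ring
  rw [h2, abs_of_nonneg (div_nonneg (mul_nonneg (sq_nonneg _) (by linarith)) h1.le),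
    div_le_iff₀ h1]
  have h3 : w ^ 2 ≤ δ ^ 2 := by gcongr
  have h4 : (98 / 100 : ℝ) ≤ (1 - w) ^ 2 := by nlinarith
  calc w ^ 2 * (3 - 2 * w) ≤ δ ^ 2 * 3 :=
        mul_le_mul h3 (by linarith) (by linarith) (sq_nonneg _)
    _ ≤ 4 * δ ^ 2 * (98 / 100) := by nlinarith [sq_nonneg δ]
    _ ≤ _ := by gcongr

theorem abs_moebius_sub_le {p z : ℝ} (hz : 0 ≤ z) (hzp : z ≤ p) (hp : p ≤ 1 / 50) :
    |(1 - p) ^ 2 / (1 - z) ^ 4 - (1 - 2 * p + 4 * z)| ≤ 60 * p ^ 2 := by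
  have h0 : 0 < 1 - z := by linarith
  have h1 : (9 / 10 : ℝ) ≤ (1 - z) ^ 4 := by
    have : (96 / 100 : ℝ) ≤ (1 - z) ^ 2 := by nlinarith
    nlinarith
  have h2 : (1 - p) ^ 2 / (1 - z) ^ 4 - (1 - 2 * p + 4 * z) =
      ((p - 4 * z) ^ 2 - (1 - 2 * p + 4 * z) * (z ^ 2 * (6 - 4 * z + z ^ 2))) / (1 - z) ^ 4 := by
    field_simp; ring
  have hzz : z ^ 2 ≤ p ^ 2 := by gcongr
  have h3 : |(p - 4 * z) ^ 2 - (1 - 2 * p + 4 * z) * (z ^ 2 * (6 - 4 * z + z ^ 2))|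
      ≤ 50 * p ^ 2 := by
    have e1 : (p - 4 * z) ^ 2 ≤ 9 * p ^ 2 := by nlinarith
    have e2 : 0 ≤ z ^ 2 * (6 - 4 * z + z ^ 2) := mul_nonneg (sq_nonneg _) (by nlinarith)
    have e3 : z ^ 2 * (6 - 4 * z + z ^ 2) ≤ p ^ 2 * 7 := by
      refine mul_le_mul hzz (by nlinarith) (by nlinarith) (sq_nonneg _)
    have e4 : 0 ≤ 1 - 2 * p + 4 * z := by linarith
    have e5 : (1 - 2 * p + 4 * z) * (z ^ 2 * (6 - 4 * z + z ^ 2)) ≤ 2 * (p ^ 2 * 7) :=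
      mul_le_mul (by linarith) e3 e2 (by norm_num)
    have e6 := mul_nonneg e4 e2
    rw [abs_le]
    constructor <;> nlinarith [sq_nonneg (p - 4 * z), sq_nonneg p]
  rw [h2, abs_div, abs_of_pos (show 0 < (1 - z) ^ 4 by positivity), div_le_iff₀ (by positivity)]
  calc _ ≤ 50 * p ^ 2 := h3
    _ ≤ 60 * p ^ 2 * (9 / 10) := by nlinarith [sq_nonneg p]
    _ ≤ _ := by gcongr

/-- A bootstrap: the hypothesis first gives `3 - N = O(δ)`, which makes the term `2w(3 - N)` of
order `δ²`. -/
theorem abs_three_sub_sub_le {N δ w A B E : ℝ} (hN0 : 0 ≤ N) (hN7 : N ≤ 7) (hδ : 0 < δ)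
    (hδ' : δ ≤ 1 / 125) (hw0 : 0 < w) (hwδ : w < δ) (hA : |A| ≤ 4 * δ ^ 2)
    (hB : |B| ≤ 60 * (3 / 2 * δ) ^ 2) (hE : E ∈ Icc 0 (δ ^ 2))
    (h : (3 - N) * (1 + 2 * w) - 3 * δ = N * A + B - E) : |3 - N - 3 * δ| ≤ 300 * δ ^ 2 := by
  have hNA : |N * A| ≤ 28 * δ ^ 2 := by
    rw [abs_mul, abs_of_nonneg hN0]
    calc N * |A| ≤ 7 * (4 * δ ^ 2) := mul_le_mul hN7 hA (abs_nonneg _) (by norm_num)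
      _ = _ := by ring
  have hδ2 : δ ^ 2 ≤ 1 / 125 * δ := by
    rw [sq]; exact mul_le_mul_of_nonneg_right hδ' hδ.le
  have b4 : |(3 - N) * (1 + 2 * w) - 3 * δ| ≤ 230 * δ ^ 2 := by
    rw [h, abs_le]
    have h1 := abs_le.1 hNA
    have h2 := abs_le.1 hB
    constructor <;> linarith [hE.1, hE.2, sq_nonneg δ]
  have b5 : |3 - N| ≤ 22 * δ := by
    have h1 : |(3 - N) * (1 + 2 * w)| ≤ 22 * δ := by
      rw [abs_le] at b4 ⊢
      constructor <;> linarith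
    rw [abs_mul] at h1
    refine (le_mul_of_one_le_right (abs_nonneg _) ?_).trans h1
    rw [abs_of_pos (by linarith)]
    linarith
  have b6 : |2 * w * (3 - N)| ≤ 44 * δ ^ 2 := by
    rw [abs_mul, abs_of_pos (show 0 < 2 * w by linarith)]
    calc 2 * w * |3 - N| ≤ 2 * δ * (22 * δ) := by gcongr
      _ = _ := by ring
  rw [abs_le] at b4 b6 ⊢
  constructor <;> linarith [sq_nonneg δ]

/-- The second order expansion of the crossing condition. -/
theorem abs_three_sub_le_of_eigenLog_eq (hl : 1000 ≤ l) (ha : a ∈ Ioo (0 : ℝ) 1)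
    (h : eigenLog 1 2 (Real.log a) = eigenLog l 1 (Real.log a)) :
    |3 - ((l : ℝ) ^ 2 - 1 / 4) * (1 - a) ^ 2 / Real.pi ^ 2 - 3 * (1 - a)|
      ≤ 300 * (1 - a) ^ 2 := by
  have hl' : (1000 : ℝ) ≤ l := by exact_mod_cast hl
  have ha2 := half_lt_of_eigenLog_eq (by omega) ha h
  obtain ⟨hT2, hT⟩ := mul_one_sub_le_of_eigenLog_eq hl ha h
  have hμ := exp_eigenLog_two_mem_Icc ha
  have h9 := nine_lt_sq_pi
  set δ := 1 - a with hδa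
  have hδ : 0 < δ := sub_pos.2 ha.2
  have hδ' : δ ≤ 1 / 125 := by nlinarith
  -- To first order the right side, scaled by `δ²/π²`, varies with `x` at rate `-2N - 4β`. As `N ≈
  -- 3`, the choice `β = -3/2` cancels the dependence on the unknown `x`.
  obtain ⟨x, hx, hM⟩ := exists_exp_eigenLog_one_eq (l := l) (by omega) ha (-(3 / 2))
    (by linarith)
  rw [← hδa, ← h] at hM
  set M := Real.exp (2 * eigenLog 1 2 (Real.log a))
  have hπ := Real.pi_pos
  obtain ⟨w, rfl⟩ : ∃ w, x = 1 - w := ⟨1 - x, by ring⟩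
  have hw0 : 0 < w := by linarith [hx.2]
  have hwδ : w < δ := by linarith [hx.1]
  set N := ((l : ℝ) ^ 2 - 1 / 4) * δ ^ 2 / Real.pi ^ 2 with hN
  have hN0 : 0 ≤ N := div_nonneg (mul_nonneg (by nlinarith) (sq_nonneg _)) (sq_nonneg _)
  have hN7 : N ≤ 7 := by
    rw [hN, div_le_iff₀ (by positivity)]
    nlinarith [sq_nonneg δ]
  have h4 : 3 / 4 / a ^ 2 ≤ 3 := by
    rw [div_le_iff₀ (by nlinarith)]; nlinarith
  set e := M - 4 * Real.pi ^ 2 / δ ^ 2 with he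
  have he0 : 0 ≤ e := by linarith [hμ.1]
  have he3 : e ≤ 3 := by linarith [hμ.2]
  have heδ : e * δ ^ 2 / Real.pi ^ 2 ∈ Icc 0 (δ ^ 2) := by
    refine ⟨by positivity, ?_⟩
    rw [div_le_iff₀ (by positivity)]
    nlinarith [sq_nonneg δ]
  have hmain : 4 + e * δ ^ 2 / Real.pi ^ 2 = N * (1 / (1 - w) ^ 2) +
      (1 - 3 / 2 * δ) ^ 2 / (1 - 3 / 2 * (δ - w)) ^ 4 := by
    have e1 : 4 + e * δ ^ 2 / Real.pi ^ 2 = M * δ ^ 2 / Real.pi ^ 2 := by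
      rw [he]; field_simp; ring
    have e2 : 1 - w ≠ 0 := by linarith
    have e3 : 1 - 3 / 2 * (δ - w) ≠ 0 := by linarith
    rw [e1, hM, hN, show 1 + -(3 / 2) * (1 - w - a) = 1 - 3 / 2 * (δ - w) by rw [hδa]; ring,
      show 1 + -(3 / 2) * δ = 1 - 3 / 2 * δ by ring]
    field_simp
  have b1 := abs_inv_sq_sub_le hw0.le hwδ.le (by linarith)
  have b2 := abs_moebius_sub_le (p := 3 / 2 * δ) (z := 3 / 2 * (δ - w))
    (by linarith) (by linarith) (by linarith)
  refine abs_three_sub_sub_le hN0 hN7 hδ hδ' hw0 hwδ b1 b2 heδ ?_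
  linear_combination hmain

theorem sqrt_three_mul_pi_mem_Icc : √3 * Real.pi ∈ Icc (3 : ℝ) 6 := by
  have h1 : (1 : ℝ) ≤ √3 := Real.one_le_sqrt.2 (by norm_num)
  have h2 : √3 ≤ (18 / 10 : ℝ) := Real.sqrt_le_iff.2 ⟨by norm_num, by norm_num⟩
  have h3 := Real.pi_gt_three
  have h4 := Real.pi_lt_d2
  constructor <;> nlinarith

theorem asymptotics_of_eigenLog_eq (hl : 1000 ≤ l) (ha : a ∈ Ioo (0 : ℝ) 1)
    (h : eigenLog 1 2 (Real.log a) = eigenLog l 1 (Real.log a)) :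
    |a - (1 - √3 * Real.pi / l)| ≤ 190000 / (l : ℝ) ^ 2 ∧
      |a - (1 - √3 * Real.pi / l + 3 * Real.pi ^ 2 / (2 * (l : ℝ) ^ 2))|
        ≤ 190000 / (l : ℝ) ^ 3 := by
  have hl' : (1000 : ℝ) ≤ l := by exact_mod_cast hl
  have hl0 : (0 : ℝ) < l := by linarith
  obtain ⟨hT2, hT⟩ := mul_one_sub_le_of_eigenLog_eq hl ha h
  have hN := abs_three_sub_le_of_eigenLog_eq hl ha h
  have hδ : 0 < 1 - a := sub_pos.2 ha.2
  obtain ⟨δ, rfl⟩ : ∃ δ, a = 1 - δ := ⟨1 - a, by ring⟩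
  simp only [sub_sub_cancel] at hT2 hT hN hδ
  have hδ' : δ ≤ 1 / 125 := by nlinarith
  have h10 := sq_pi_lt_ten
  have h9 := nine_lt_sq_pi
  have hS := sqrt_three_mul_pi_mem_Icc
  set S := √3 * Real.pi with hSdef
  have hS2 : S ^ 2 = 3 * Real.pi ^ 2 := by
    rw [hSdef, mul_pow, Real.sq_sqrt (by norm_num)]
  have hδ2 := sq_nonneg δ
  -- `(1 - δ/2)²` replaces `1 - δ` at a cost of order `δ²`, so a square root can be taken exactly.
  have k1 : |(l * δ) ^ 2 - (S * (1 - δ / 2)) ^ 2| ≤ 3010 * δ ^ 2 := by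
    have e : (l * δ) ^ 2 - (S * (1 - δ / 2)) ^ 2 = -(Real.pi ^ 2 *
        (3 - ((l : ℝ) ^ 2 - 1 / 4) * δ ^ 2 / Real.pi ^ 2 - 3 * δ))
        + δ ^ 2 / 4 - 3 * Real.pi ^ 2 * δ ^ 2 / 4 := by
      have := Real.pi_pos.ne'
      rw [mul_pow S, hS2]; field_simp; ring
    have e2 : |Real.pi ^ 2 * (3 - ((l : ℝ) ^ 2 - 1 / 4) * δ ^ 2 / Real.pi ^ 2 - 3 * δ)|
        ≤ 10 * (300 * δ ^ 2) := by
      rw [abs_mul, abs_of_nonneg (sq_nonneg Real.pi)]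
      gcongr
    rw [e]
    rw [abs_le] at e2 ⊢
    constructor <;> nlinarith
  have hT0 : 1 ≤ S * (1 - δ / 2) := by nlinarith [hS.1]
  have k2 : |l * δ - S * (1 - δ / 2)| ≤ 181000 / (l : ℝ) ^ 2 := by
    rw [sq_sub_sq, abs_mul] at k1
    have hp : 1 ≤ |l * δ + S * (1 - δ / 2)| := by
      rw [abs_of_pos (by positivity)]; nlinarith [mul_pos hl0 hδ]
    have h1 : |l * δ - S * (1 - δ / 2)| ≤ 3010 * δ ^ 2 :=
      (le_mul_of_one_le_left (abs_nonneg _) hp).trans k1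
    refine h1.trans ?_
    rw [le_div_iff₀ (by positivity)]
    nlinarith
  have k3 : |δ - S / l + S * δ / (2 * l)| ≤ 181000 / (l : ℝ) ^ 3 := by
    have e : δ - S / l + S * δ / (2 * l) = (l * δ - S * (1 - δ / 2)) / l := by
      field_simp; ring
    rw [e, abs_div, abs_of_pos hl0, pow_succ, ← div_div]
    gcongr
  have k4 : |δ - S / l| ≤ 2000 / (l : ℝ) ^ 2 := by
    have e1 : S * δ / (2 * l) ≤ 24 / (l : ℝ) ^ 2 := by
      rw [div_le_div_iff₀ (by positivity) (by positivity)]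
      have : S * (l * δ) ≤ 6 * 8 := mul_le_mul hS.2 hT (by positivity) (by norm_num)
      nlinarith
    have e2 : 181000 / (l : ℝ) ^ 3 ≤ 181 / (l : ℝ) ^ 2 := by
      rw [div_le_div_iff₀ (by positivity) (by positivity)]
      nlinarith [sq_nonneg (l : ℝ), mul_le_mul_of_nonneg_right hl' (sq_nonneg (l : ℝ))]
    have e3 : 0 ≤ S * δ / (2 * l) := by have := hS.1; positivity
    have e4 : 24 / (l : ℝ) ^ 2 + 181 / (l : ℝ) ^ 2 ≤ 2000 / (l : ℝ) ^ 2 := by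
      rw [← add_div]; gcongr; norm_num
    rw [abs_le] at k3 ⊢
    constructor <;> linarith
  have k5 : |δ - S / l + 3 * Real.pi ^ 2 / (2 * (l : ℝ) ^ 2)| ≤ 190000 / (l : ℝ) ^ 3 := by
    -- Substituting the first-order result `δ ≈ S/l` into the correction `Sδ/(2l)` yields `S²/(2l²)
    -- = 3π²/(2l²)`.
    have e : δ - S / l + 3 * Real.pi ^ 2 / (2 * (l : ℝ) ^ 2) =
        (δ - S / l + S * δ / (2 * l)) - S / (2 * l) * (δ - S / l) := by
      rw [← hS2]; field_simp; ring
    have e1 : |S / (2 * l) * (δ - S / l)| ≤ 6000 / (l : ℝ) ^ 3 := by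
      rw [abs_mul, abs_of_nonneg (by have := hS.1; positivity)]
      calc S / (2 * l) * |δ - S / l| ≤ 6 / (2 * l) * (2000 / (l : ℝ) ^ 2) := by
            have := hS.2
            gcongr
        _ = _ := by field_simp; norm_num
    have e2 : 181000 / (l : ℝ) ^ 3 + 6000 / (l : ℝ) ^ 3 ≤ 190000 / (l : ℝ) ^ 3 := by
      rw [← add_div]; gcongr; norm_num
    rw [e]
    exact (abs_sub _ _).trans ((add_le_add k3 e1).trans e2)
  constructor
  · rw [show 1 - δ - (1 - S / l) = -(δ - S / l) by ring, abs_neg]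
    refine k4.trans ?_
    gcongr
    norm_num
  · rw [show 1 - δ - (1 - S / l + 3 * Real.pi ^ 2 / (2 * (l : ℝ) ^ 2)) =
      -(δ - S / l + 3 * Real.pi ^ 2 / (2 * (l : ℝ) ^ 2)) by ring, abs_neg]
    exact k5

/-- The hypothesis of `boundaryRatio_lt_exp`: at the crossing the eigenvalue is about `4l²/3`, and
the crude bound `N ≥ 5/2` already gives `8l²/5 + 3`. -/
theorem exp_eigenLog_le_of_eigenLog_eq (hl : 1000 ≤ l) (ha : a ∈ Ioo (0 : ℝ) 1)
    (h : eigenLog 1 2 (Real.log a) = eigenLog l 1 (Real.log a)) :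
    Real.exp (2 * eigenLog l 1 (Real.log a)) ≤ 2 * ((l : ℝ) ^ 2 - 1) := by
  have hl' : (1000 : ℝ) ≤ l := by exact_mod_cast hl
  have ha2 := half_lt_of_eigenLog_eq (by omega) ha h
  obtain ⟨hT2, hT⟩ := mul_one_sub_le_of_eigenLog_eq hl ha h
  have hN := abs_le.1 (abs_three_sub_le_of_eigenLog_eq hl ha h)
  have hμ := (exp_eigenLog_two_mem_Icc ha).2
  rw [h] at hμ
  have h9 := nine_lt_sq_pi
  set δ := 1 - a with hδa
  have hδ : 0 < δ := sub_pos.2 ha.2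
  have hδ' : δ ≤ 1 / 125 := by nlinarith
  have h4 : 3 / 4 / a ^ 2 ≤ 3 := by
    rw [div_le_iff₀ (by nlinarith)]; nlinarith
  have h1 : 5 / 2 ≤ ((l : ℝ) ^ 2 - 1 / 4) * δ ^ 2 / Real.pi ^ 2 := by nlinarith
  rw [le_div_iff₀ (by positivity)] at h1
  have h2 : 4 * Real.pi ^ 2 / δ ^ 2 ≤ 8 / 5 * (l : ℝ) ^ 2 := by
    rw [div_le_iff₀ (by positivity)]
    nlinarith [sq_nonneg δ]
  nlinarith

/-- Intermediate values on `[1/2, 1 - 1/l]`: on the left `μ < 163 < l² < λ`; on the right `μ ≥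
4π²l²` exceeds `λ ≤ (2 + π²) l²`. -/
theorem exists_eigenLog_eq (hl : 1000 ≤ l) :
    ∃ a ∈ Ioo (0 : ℝ) 1, eigenLog 1 2 (Real.log a) = eigenLog l 1 (Real.log a) := by
  have hl' : (1000 : ℝ) ≤ l := by exact_mod_cast hl
  have hl0 : (0 : ℝ) < l := by linarith
  have hinv : 1 / (l : ℝ) ≤ 1 / 1000 := one_div_le_one_div_of_le (by norm_num) hl'
  have hinv0 : 0 < 1 / (l : ℝ) := by positivity
  have h1l : 1 ≤ l := by omega
  let F : ℝ → ℝ := fun a ↦ eigenLog 1 2 (Real.log a) - eigenLog l 1 (Real.log a)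
  have hF : ContinuousOn F (Icc (1 / 2) (1 - 1 / l)) := by
    intro x hx
    have hx0 : 0 < x := by linarith [hx.1]
    have hb : Real.log x < 0 := Real.log_neg hx0 (by linarith [hx.2])
    have hlog := Real.continuousAt_log hx0.ne'
    exact (((continuousAt_eigenLog le_rfl (by norm_num) hb).comp hlog).sub
      ((continuousAt_eigenLog h1l le_rfl hb).comp hlog)).continuousWithinAt
  have hleft : F (1 / 2) ≤ 0 := by
    have h1 := exp_eigenLog_two_lt_of_le_half (a := 1 / 2) ⟨by norm_num, by norm_num⟩ le_rfl
    have h2 := sq_lt_exp_eigenLog (b := Real.log (1 / 2)) h1l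
      (Real.log_neg (by norm_num) (by norm_num))
    have h3 := Real.exp_lt_exp.1 (h1.trans (lt_trans (by nlinarith) h2))
    simp only [F]; linarith
  have hright : 0 ≤ F (1 - 1 / l) := by
    have ha : 1 - 1 / (l : ℝ) ∈ Ioo (0 : ℝ) 1 := ⟨by linarith, by linarith⟩
    have h1 := (exp_eigenLog_two_mem_Icc ha).1
    obtain ⟨x, hx, h2⟩ := exists_exp_eigenLog_one_eq_const h1l ha
    rw [sub_sub_cancel, one_div, inv_pow, div_inv_eq_mul] at h1 h2
    have h3 : ((l : ℝ) ^ 2 - 1 / 4) / x ^ 2 ≤ 2 * (l : ℝ) ^ 2 := by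
      have : 1 / 2 ≤ x ^ 2 := by nlinarith [hx.1]
      rw [div_le_iff₀ (by linarith)]
      nlinarith [sq_nonneg (l : ℝ)]
    rw [one_div] at h2
    have h4 := Real.exp_le_exp.1 (show Real.exp (2 * eigenLog l 1 (Real.log (1 - (l : ℝ)⁻¹))) ≤
      Real.exp (2 * eigenLog 1 2 (Real.log (1 - (l : ℝ)⁻¹))) by
        nlinarith [nine_lt_sq_pi, sq_nonneg (l : ℝ),
          mul_nonneg (sub_nonneg.2 nine_lt_sq_pi.le) (sq_nonneg (l : ℝ))])
    simp only [F, one_div]; linarith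
  obtain ⟨a, ha, h⟩ := intermediate_value_Icc (by linarith) hF ⟨hleft, hright⟩
  exact ⟨a, ⟨by linarith [ha.1], by linarith [ha.2]⟩, sub_eq_zero.1 h⟩

end Bounds

/-! ### Derivatives of the eigenvalues and transversality. -/

section Derivative

theorem hasDerivAt_exp_eigenLog_log {l n : ℕ} {a : ℝ} (hl : 1 ≤ l) (hn : 1 ≤ n)
    (ha : a ∈ Ioo (0 : ℝ) 1) :
    HasDerivAt (fun a ↦ Real.exp (2 * eigenLog l n (Real.log a)))
      (Real.exp (2 * eigenLog l n (Real.log a)) * (2 *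
        (boundaryRatio l (eigenLog l n (Real.log a)) (Real.log a) /
          (1 - boundaryRatio l (eigenLog l n (Real.log a)) (Real.log a)) * a⁻¹))) a :=
  (((hasDerivAt_eigenLog hl hn (Real.log_neg ha.1 ha.2)).comp a
    (Real.hasDerivAt_log ha.1.ne')).const_mul 2).exp

theorem hasDerivAt_dirichletEigenvalue {l : ℕ} {a : ℝ} (hl : 1 ≤ l) (n : ℕ)
    (ha : a ∈ Ioo (0 : ℝ) 1) :
    HasDerivAt (dirichletEigenvalue l n)
      (Real.exp (2 * eigenLog l (n + 1) (Real.log a)) * (2 *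
        (boundaryRatio l (eigenLog l (n + 1) (Real.log a)) (Real.log a) /
          (1 - boundaryRatio l (eigenLog l (n + 1) (Real.log a)) (Real.log a)) * a⁻¹))) a := by
  refine (hasDerivAt_exp_eigenLog_log hl (by omega) ha).congr_of_eventuallyEq ?_
  filter_upwards [Ioo_mem_nhds ha.1 ha.2] with x hx using dirichletEigenvalue_eq hl n hx

theorem hasDerivAt_neumannEigenvalue_zero_succ {a : ℝ} (n : ℕ) (ha : a ∈ Ioo (0 : ℝ) 1) :
    HasDerivAt (neumannEigenvalue 0 (n + 1))
      (Real.exp (2 * eigenLog 1 (n + 1) (Real.log a)) * (2 *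
        (boundaryRatio 1 (eigenLog 1 (n + 1) (Real.log a)) (Real.log a) /
          (1 - boundaryRatio 1 (eigenLog 1 (n + 1) (Real.log a)) (Real.log a)) * a⁻¹))) a := by
  refine (hasDerivAt_exp_eigenLog_log le_rfl (by omega) ha).congr_of_eventuallyEq ?_
  filter_upwards [Ioo_mem_nhds ha.1 ha.2] with x hx using neumannEigenvalue_zero_succ_eq n hx

theorem boundaryRatio_lt_boundaryRatio {l : ℕ} {a : ℝ} (hl : 1000 ≤ l) (ha : a ∈ Ioo (0 : ℝ) 1)
    (h : eigenLog 1 2 (Real.log a) = eigenLog l 1 (Real.log a)) :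
    boundaryRatio l (eigenLog l 1 (Real.log a)) (Real.log a) <
      boundaryRatio 1 (eigenLog 1 2 (Real.log a)) (Real.log a) := by
  have hb := Real.log_neg ha.1 ha.2
  exact (boundaryRatio_lt_exp hb (exp_eigenLog_le_of_eigenLog_eq hl ha h)
    (phaseGap_eigenLog (by omega) le_rfl hb)).trans
    (exp_lt_boundaryRatio_one hb (phaseGap_eigenLog le_rfl (by norm_num) hb))

end Derivative

end Annulus

theorem proposition2p3 :
    ∃ (L : ℕ) (C : ℝ), ∀ l : ℕ, L ≤ l →
      (∃ a ∈ Set.Ioo (0 : ℝ) 1,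
        Annulus.neumannEigenvalue 0 2 a = Annulus.dirichletEigenvalue l 0 a) ∧
      ∀ a ∈ Set.Ioo (0 : ℝ) 1,
        Annulus.neumannEigenvalue 0 2 a = Annulus.dirichletEigenvalue l 0 a →
        |a - (1 - √3 * Real.pi / (l : ℝ))| ≤ C / (l : ℝ) ^ 2 ∧
        |a - (1 - √3 * Real.pi / (l : ℝ) + 3 * Real.pi ^ 2 / (2 * (l : ℝ) ^ 2))|
          ≤ C / (l : ℝ) ^ 3 ∧
        DifferentiableAt ℝ (Annulus.neumannEigenvalue 0 2) a ∧
        DifferentiableAt ℝ (Annulus.dirichletEigenvalue l 0) a ∧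
        deriv (Annulus.neumannEigenvalue 0 2) a ≠ deriv (Annulus.dirichletEigenvalue l 0) a := by
  refine ⟨1000, 190000, fun l hl ↦ ⟨?_, fun a ha heq ↦ ?_⟩⟩
  · obtain ⟨a, ha, h⟩ := Annulus.exists_eigenLog_eq hl
    refine ⟨a, ha, ?_⟩
    rw [Annulus.neumannEigenvalue_zero_succ_eq 1 ha,
      Annulus.dirichletEigenvalue_eq (by omega) 0 ha]
    simp only [Nat.reduceAdd, h]
  · have h : Annulus.eigenLog 1 2 (Real.log a) = Annulus.eigenLog l 1 (Real.log a) := by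
      rw [Annulus.neumannEigenvalue_zero_succ_eq 1 ha,
        Annulus.dirichletEigenvalue_eq (by omega) 0 ha] at heq
      have := Real.exp_injective heq
      simp only [Nat.reduceAdd] at this
      linarith
    have hN := Annulus.hasDerivAt_neumannEigenvalue_zero_succ 1 ha
    have hD := Annulus.hasDerivAt_dirichletEigenvalue (l := l) (by omega) 0 ha
    obtain ⟨h1, h2⟩ := Annulus.asymptotics_of_eigenLog_eq hl ha h
    refine ⟨h1, h2, hN.differentiableAt, hD.differentiableAt, ?_⟩
    rw [hN.deriv, hD.deriv]
    have hb := Real.log_neg ha.1 ha.2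
    have hlt := Annulus.boundaryRatio_lt_boundaryRatio hl ha h
    have hR := Annulus.boundaryRatio_lt_one hb
      (Annulus.phaseGap_eigenLog (l := 1) (n := 2) le_rfl (by norm_num) hb)
    simp only [Nat.reduceAdd] at *
    rw [← h] at hlt ⊢
    set R := Annulus.boundaryRatio 1 (Annulus.eigenLog 1 2 (Real.log a)) (Real.log a)
    set R' := Annulus.boundaryRatio l (Annulus.eigenLog 1 2 (Real.log a)) (Real.log a)
    intro hcon
    have h3 := mul_left_cancel₀ two_ne_zero (mul_left_cancel₀ (Real.exp_pos _).ne' hcon)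
    have h4 := mul_right_cancel₀ (inv_ne_zero ha.1.ne') h3
    -- `R ↦ R/(1-R)` is injective below `1`, so equal derivatives would force equal boundary ratios.
    rw [div_eq_div_iff (by linarith) (by linarith)] at h4
    linarith
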